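/- For a skew-symmetric $2\times 2$ matrix valued kernel $K$ on $\mathbb R$ and $x_0\in\mathbb R$, the Fredholm Pfaffian on $\mathbb L^2(x_0,\infty)$ is $$\mathrm{Pf}[J+K]_{\mathbb L^2(x_0,\infty)}=1+\sum_{k\ge 1}\frac1{k!}\int_{(x_0,\infty)^k}\mathrm{Pf}\big[K(x_i,x_j)\big]_{i,j=1}^k\,dx_1\cdots dx_k ,$$ where $\mathrm{Pf}[M]=\frac{1}{2^kk!}\sum_{\sigma\in\mathcal S_{2k}}\mathrm{sign}(\sigma)M_{\sigma(1)\sigma(2)}\cdots M_{\sigma(2k-1)\sigma(2k)}$ and $[K(x_i,x_j)]$ is made of $k^2$ blocks of size $2\times2$. If the entry $K_{22}$ contains a multiple of $\delta'(x,y)$, the integral of the Pfaffian is defined by expanding $\mathrm{Pf}[K(x_i,x_j)]$ and letting the factors $\delta'(x_i,x_j)$ (which involve disjoint pairs of variables in each term) act by $\iint_{(x_0,\infty)^2} f(x,y)\,\delta'(x,y)\,dx\,dy=\int_{x_0}^\infty(\partial_yf-\partial_xf)(x,x)\,dx$. **Proposition.** Let $A:\mathbb R^2\to\mathbb R$ be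 smooth with $A(x,y)=-A(y,x)$, and let $$\mathbf A=\begin{pmatrix}A&-\partial_yA\\-\partial_xA&\partial_x\partial_yA\end{pmatrix},\qquad \mathbf B=\begin{pmatrix}A&-2\partial_yA\\-2\partial_xA&4\partial_x\partial_yA+\delta'\end{pmatrix}.$$ Let $x_0\in\mathbb R$ and assume that there are constants $C>0$ and $a>b\ge0$ such that for all $x,y>x_0$ $$|\mathbf A_{11}(x,y)|<Ce^{-ax-ay},\quad |\mathbf A_{12}(x,y)|<Ce^{-ax+by},\quad |\mathbf A_{22}(x,y)|<Ce^{bx+by}.$$ Then all integrals in the expansions of $\mathrm{Pf}[J-\mathbf A]$ and $\mathrm{Pf}[J-\mathbf B]$ on $\mathbb L^2(x_0,\infty)$ exist, both series converge absolutely, and $$\mathrm{Pf}[J-\mathbf A]_{\mathbb L^2(x_0,\infty)}=\mathrm{Pf}[J-\mathbf B]_{\mathbb L^2(x_0,\infty)}.$$ In particular, let $K^{\rm GSE}$ be the kernel with $$K^{\rm GSE}_{11}=\iint\frac{z-w}{4zw(z+w)}E,\quad K^{\rm GSE}_{12}=\iint\frac{z-w}{4z(z+w)}E,\quad K^{\rm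 GSE}_{22}=\iint\frac{z-w}{4(z+w)}E,\quad K^{\rm GSE}_{21}(x,y)=-K^{\rm GSE}_{12}(y,x),$$ where $E=e^{z^3/3+w^3/3-xz-yw}$ and $\iint$ stands for $\frac{1}{(2i\pi)^2}\int dz\int dw$, with $z$ and $w$ both running over the two rays from $1$ with angles $\pm\pi/3$, oriented from $1+\infty e^{-i\pi/3}$ to $1+\infty e^{i\pi/3}$. Then $K^{\rm GSE}$ is real, $A=K^{\rm GSE}_{11}$ is smooth and antisymmetric on $\mathbb R^2$, and $K^{\rm GSE}=\begin{pmatrix}A&-\partial_yA\\-\partial_xA&\partial_x\partial_yA\end{pmatrix}$. With $$K^\infty=\begin{pmatrix}A&-2\partial_yA\\-2\partial_xA&4\partial_x\partial_yA+\delta'\end{pmatrix}$$ one has, for every $x_0\in\mathbb R$, absolutely convergent expansions and $\mathrm{Pf}[J-K^{\rm GSE}]_{\mathbb L^2(x_0,\infty)}=\mathrm{Pf}[J-K^\infty]_{\mathbb L^2(x_0,\infty)}$. -/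

import Mathlib

open scoped ContDiff Nat
open MeasureTheory

noncomputable section

namespace FredholmPf

/-! ### Pfaffians and Fredholm Pfaffians of ordinary matrix kernels -/

/-- The Pfaffian of a `2k × 2k` matrix made of `k²` blocks of size `2 × 2`. The index `(l, 0)`
stands for `2l - 1` and `(l, 1)` for `2l` (with `l = 1, …, k`), so this is
`1 / (2^k k!) ∑_σ sign(σ) M_{σ(1)σ(2)} M_{σ(3)σ(4)} ⋯ M_{σ(2k-1)σ(2k)}`. -/
def pfaffian {k : ℕ} (M : Matrix (Fin k × Fin 2) (Fin k × Fin 2) ℝ) : ℝ :=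
  1 / (2 ^ k * (k ! : ℝ)) *
    ∑ σ : Equiv.Perm (Fin k × Fin 2),
      ((Equiv.Perm.sign σ : ℤ) : ℝ) * ∏ l : Fin k, M (σ (l, 0)) (σ (l, 1))

/-- A `2 × 2` matrix valued kernel on `ℝ`. -/
abbrev Kernel : Type := ℝ → ℝ → Matrix (Fin 2) (Fin 2) ℝ

/-- The `2k × 2k` matrix with `2 × 2` blocks `K (x i) (x j)`. -/
def blockMatrix (K : Kernel) {k : ℕ} (x : Fin k → ℝ) :
    Matrix (Fin k × Fin 2) (Fin k × Fin 2) ℝ :=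
  Matrix.of fun p q => K (x p.1) (x q.1) p.2 q.2

/-- `1 / k! ∫_{S^k} Pf [K(x_i, x_j)] dx_1 ⋯ dx_k`. For `k = 0` this is `1`. -/
def fredholmTerm (K : Kernel) (S : Set ℝ) (k : ℕ) : ℝ :=
  1 / (k ! : ℝ) * ∫ x in Set.univ.pi (fun _ : Fin k => S), pfaffian (blockMatrix K x)

/-- The Fredholm Pfaffian `Pf (J + K)` on `L²(S)`. -/
def fredholmPfaffian (K : Kernel) (S : Set ℝ) : ℝ :=
  ∑' k : ℕ, fredholmTerm K S k

/-- All integrals in the expansion of `Pf (J + K)` on `L²(S)` exist, and the series converges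
absolutely (for real series, `Summable` is absolute convergence). -/
def FredholmConverges (K : Kernel) (S : Set ℝ) : Prop :=
  (∀ k : ℕ, IntegrableOn (fun x : Fin k → ℝ => pfaffian (blockMatrix K x))
    (Set.univ.pi fun _ => S)) ∧
  Summable fun k : ℕ => fredholmTerm K S k

/-! ### The distribution `δ'` -/

/-- `∏_{(i, j) ∈ P} (∂_{x_j} - ∂_{x_i}) F`. -/
def deltaPrimeDeriv {ι : Type} [Fintype ι] [DecidableEq ι] (P : List (ι × ι))
    (F : (ι → ℝ) → ℝ) : (ι → ℝ) → ℝ :=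
  P.foldr (fun p G x => lineDeriv ℝ G x (Pi.single p.2 1 - Pi.single p.1 1)) F

/-- Sends `j` to `i` for each `(i, j) ∈ P` and fixes every other index. -/
def identify {ι : Type} [DecidableEq ι] (P : List (ι × ι)) : ι → ι :=
  P.foldr (fun p f => Function.update f p.2 p.1) id

/-- The integrand which remains when `∏_{(i, j) ∈ P} δ'(x_i, x_j)` is applied to `F`, for a list
`P` of disjoint pairs of indices: `∏_{(i, j) ∈ P} (∂_{x_j} - ∂_{x_i}) F`, restricted to the
diagonals `x_j = x_i`. It is a function of the variables that remain when each `x_j` has been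
identified with `x_i`. -/
def deltaPrimeIntegrand {ι : Type} [Fintype ι] [DecidableEq ι] (P : List (ι × ι))
    (F : (ι → ℝ) → ℝ) (y : Set.range (identify P) → ℝ) : ℝ :=
  deltaPrimeDeriv P F fun i => y (Set.rangeFactorization (identify P) i)

/-- `∫_{S^ι} ∏_{(i, j) ∈ P} δ'(x_i, x_j) F(x) dx` for a list `P` of disjoint pairs of indices,
where `∫∫_{S²} f(x, y) δ'(x, y) dx dy = ∫_S (∂_y f - ∂_x f)(x, x) dx`. -/
def deltaPrimeIntegral {ι : Type} [Fintype ι] [DecidableEq ι] (S : Set ℝ) (P : List (ι × ι))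
    (F : (ι → ℝ) → ℝ) : ℝ :=
  ∫ y in Set.univ.pi (fun _ : Set.range (identify P) => S), deltaPrimeIntegrand P F y

/-! ### Fredholm Pfaffians of kernels involving `δ'` -/

/-- The distribution valued kernel `regular(x, y) + coeff * [[0, 0], [0, δ'(x, y)]]`. -/
structure DeltaKernel where
  /-- the function part -/
  regular : Kernel
  /-- the coefficient of `δ'` in the entry `22` -/
  coeff : ℝ

instance : Neg DeltaKernel := ⟨fun B => ⟨-B.regular, -B.coeff⟩⟩

/-- The factors, in the summand of the Pfaffian with index `σ`, whose row and column both are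
second rows and columns of a `2 × 2` block. These are the factors
`regular_{22}(x_i, x_j) + coeff * δ'(x_i, x_j)`; a choice `D` of `δ'` is possible in these only. -/
def Admissible {k : ℕ} (σ : Equiv.Perm (Fin k × Fin 2)) (D : Finset (Fin k)) : Prop :=
  ∀ l ∈ D, (σ (l, 0)).2 = 1 ∧ (σ (l, 1)).2 = 1

instance {k : ℕ} (σ : Equiv.Perm (Fin k × Fin 2)) : DecidablePred (Admissible σ) :=
  fun D => inferInstanceAs (Decidable (∀ l ∈ D, (σ (l, 0)).2 = 1 ∧ (σ (l, 1)).2 = 1))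

/-- The list of the pairs `(i, j)` such that `δ'(x_i, x_j)` is taken from a factor in `D`.
They are disjoint if `D` is admissible. -/
def deltaPairs {k : ℕ} (σ : Equiv.Perm (Fin k × Fin 2)) (D : Finset (Fin k)) :
    List (Fin k × Fin k) :=
  ((List.finRange k).filter fun l => l ∈ D).map fun l => ((σ (l, 0)).1, (σ (l, 1)).1)

namespace DeltaKernel

/-- The product of the function parts of the factors that are not in `D`. -/
def regularProd (B : DeltaKernel) {k : ℕ} (σ : Equiv.Perm (Fin k × Fin 2))
    (D : Finset (Fin k)) (x : Fin k → ℝ) : ℝ :=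
  ∏ l ∈ Dᶜ, blockMatrix B.regular x (σ (l, 0)) (σ (l, 1))

/-- `∫_{S^k} Pf [B(x_i, x_j)] dx_1 ⋯ dx_k`: the Pfaffian is expanded into products of entries,
each product is multiplied out into terms
`coeff^{#D} ∏_{l ∈ D} δ'(x_{i_l}, x_{j_l}) ∏_{l ∉ D} regular(⋯)`, and `δ'` acts in each term on the
function it is multiplied with. -/
def pfaffianIntegral (B : DeltaKernel) (S : Set ℝ) (k : ℕ) : ℝ :=
  1 / (2 ^ k * (k ! : ℝ)) *
    ∑ σ : Equiv.Perm (Fin k × Fin 2), ((Equiv.Perm.sign σ : ℤ) : ℝ) *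
      ∑ D : Finset (Fin k) with Admissible σ D,
        B.coeff ^ D.card * deltaPrimeIntegral S (deltaPairs σ D) (B.regularProd σ D)

/-- `1 / k! ∫_{S^k} Pf [B(x_i, x_j)] dx_1 ⋯ dx_k`. For `k = 0` this is `1`. -/
def fredholmTerm (B : DeltaKernel) (S : Set ℝ) (k : ℕ) : ℝ :=
  1 / (k ! : ℝ) * B.pfaffianIntegral S k

/-- The Fredholm Pfaffian `Pf (J + B)` on `L²(S)`. -/
def fredholmPfaffian (B : DeltaKernel) (S : Set ℝ) : ℝ :=
  ∑' k : ℕ, B.fredholmTerm S k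

/-- All integrals in the expansion of `Pf (J + B)` on `L²(S)` exist, and the series converges
absolutely. -/
def FredholmConverges (B : DeltaKernel) (S : Set ℝ) : Prop :=
  (∀ (k : ℕ) (σ : Equiv.Perm (Fin k × Fin 2)) (D : Finset (Fin k)), Admissible σ D →
    IntegrableOn (deltaPrimeIntegrand (deltaPairs σ D) (B.regularProd σ D))
      (Set.univ.pi fun _ => S)) ∧
  Summable fun k : ℕ => B.fredholmTerm S k

end DeltaKernel

/-! ### The kernels `𝐀` and `𝐁` built from a scalar kernel `A` -/

/-- `∂_x A (x, y)` -/
def partialX (A : ℝ → ℝ → ℝ) (x y : ℝ) : ℝ := deriv (fun s => A s y) x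

/-- `∂_y A (x, y)` -/
def partialY (A : ℝ → ℝ → ℝ) (x y : ℝ) : ℝ := deriv (fun t => A x t) y

/-- `[[A, -∂_y A], [-∂_x A, ∂_x ∂_y A]]` -/
def kernelA (A : ℝ → ℝ → ℝ) : Kernel := fun x y =>
  !![A x y, -partialY A x y; -partialX A x y, partialX (partialY A) x y]

/-- `[[A, -2 ∂_y A], [-2 ∂_x A, 4 ∂_x ∂_y A + δ']]` -/
def kernelB (A : ℝ → ℝ → ℝ) : DeltaKernel where
  regular := fun x y =>
    !![A x y, -2 * partialY A x y; -2 * partialX A x y, 4 * partialX (partialY A) x y]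
  coeff := 1

/-- The exponential decay bounds, on `S × S`. -/
def ExpDecayOn (K : Kernel) (S : Set ℝ) : Prop :=
  ∃ C a b : ℝ, 0 < C ∧ 0 ≤ b ∧ b < a ∧ ∀ x ∈ S, ∀ y ∈ S,
    |K x y 0 0| < C * Real.exp (-a * x - a * y) ∧
    |K x y 0 1| < C * Real.exp (-a * x + b * y) ∧
    |K x y 1 1| < C * Real.exp (b * x + b * y)

/-! ### The GSE kernel -/

/-- `1 / (2 i π) ∫ f(z) dz` along the two rays which depart from `a` with angles `θ` and `-θ`,
oriented from `a + ∞ e^{-iθ}` to `a + ∞ e^{iθ}`. -/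
def rayIntegral (a : ℂ) (θ : ℝ) (f : ℂ → ℂ) : ℂ :=
  1 / (2 * Real.pi * Complex.I) *
    ((∫ t in Set.Ioi (0 : ℝ), f (a + t * Complex.exp (θ * Complex.I)) *
        Complex.exp (θ * Complex.I)) -
      ∫ t in Set.Ioi (0 : ℝ), f (a + t * Complex.exp (-θ * Complex.I)) *
        Complex.exp (-θ * Complex.I))

/-- `∫ dz ∫ dw g(z, w) exp (z³/3 + w³/3 - x z - y w)`, both integrals along the rays from `1` with
angles `± π/3`, and with a factor `1 / (2 i π)` each. -/
def airyDoubleIntegral (g : ℂ → ℂ → ℂ) (x y : ℝ) : ℂ :=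
  rayIntegral 1 (Real.pi / 3) fun z => rayIntegral 1 (Real.pi / 3) fun w =>
    g z w * Complex.exp (z ^ 3 / 3 + w ^ 3 / 3 - x * z - y * w)

/-- The entry `11` of the GSE kernel. -/
def gse11 (x y : ℝ) : ℂ :=
  airyDoubleIntegral (fun z w => (z - w) / (4 * z * w * (z + w))) x y

/-- The entry `12` of the GSE kernel. -/
def gse12 (x y : ℝ) : ℂ :=
  airyDoubleIntegral (fun z w => (z - w) / (4 * z * (z + w))) x y

/-- The entry `22` of the GSE kernel. -/
def gse22 (x y : ℝ) : ℂ :=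
  airyDoubleIntegral (fun z w => (z - w) / (4 * (z + w))) x y

/-- The GSE kernel, given by complex contour integrals. -/
def gseContourKernel (x y : ℝ) : Matrix (Fin 2) (Fin 2) ℂ :=
  !![gse11 x y, gse12 x y; -gse12 y x, gse22 x y]

/-- The GSE kernel as a real kernel (the contour integrals are real). -/
def kernelGSE : Kernel := fun x y => (gseContourKernel x y).map Complex.re

/-- The entry `11` of the GSE kernel, as a real kernel. -/
def scalarGSE (x y : ℝ) : ℝ := kernelGSE x y 0 0

/-- The kernel `K^∞ = [[A, -2 ∂_y A], [-2 ∂_x A, 4 ∂_x ∂_y A + δ']]` with `A = K^GSE_11`. -/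
def kernelInfinity : DeltaKernel := kernelB scalarGSE

end FredholmPf

end

noncomputable section

namespace FredholmPf

/-!
The second row and column of `𝐀` are minus the derivatives of the first. Hence, when `δ'(x, y)` acts
on a monomial of `Pf [𝐁(x_i, x_j)]`, the product rule turns it back into monomials of `𝐀` on one
variable fewer, with both indices of the merged variable accounted for. Collecting the terms with
`m` factors `δ'`, the `k`-th term of the expansion for `𝐁` is the sum over `n + m = k` of
`(-1)^m 2^{n-m} (n choose m)` times the `n`-th term for `𝐀`. Hadamard's inequality for Pfaffians
bounds the `n`-th term of `𝐀` by `n^{n/2} c^n / n!`, so the double series converges absolutely, and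
summing over `m` first leaves the factor `(2 - 1)^n = 1`.

The entries of the GSE kernel are Laplace integrals over the contours, whose derivatives in `x` and
`y` multiply the density by `-z` and `-w`. Complex conjugation and the exchange of `z` and `w` act
on the contours, which gives that the kernel is real and skew-symmetric.
-/

/-! ### Permutations with prescribed values on the positions of the `δ'` factors -/

section Assemble

variable {α β V : Type*}

/-- The doubled set of positions `(α ⊕ β × Fin 2) × Fin 2`, with the positions over `β × {1}`,
which are those of the `δ'` factors, split off. -/
def positionEquiv (α β : Type*) :
    ((α ⊕ β × Fin 2) × Fin 2) ≃ ((α ⊕ β) × Fin 2) ⊕ (β × Fin 2) where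
  toFun
    | (Sum.inl a, s) => Sum.inl (Sum.inl a, s)
    | (Sum.inr (b, 0), s) => Sum.inl (Sum.inr b, s)
    | (Sum.inr (b, 1), s) => Sum.inr (b, s)
  invFun
    | Sum.inl (Sum.inl a, s) => (Sum.inl a, s)
    | Sum.inl (Sum.inr b, s) => (Sum.inr (b, 0), s)
    | Sum.inr (b, s) => (Sum.inr (b, 1), s)
  left_inv := by
    rintro ⟨a | ⟨b, u⟩, s⟩
    · rfl
    · fin_cases u <;> rfl
  right_inv := by rintro (⟨a | b, s⟩ | ⟨b, s⟩) <;> rfl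

/-- The involution which exchanges `((b, u), s)` and `((b, s), u)`. -/
def twist (α β : Type*) : Equiv.Perm ((α ⊕ β × Fin 2) × Fin 2) :=
  ((Equiv.sumProdDistrib α (β × Fin 2) (Fin 2)).trans
    (Equiv.Perm.sumCongr 1 (((Equiv.prodAssoc β (Fin 2) (Fin 2)).trans
      (Equiv.prodCongrRight fun _ => Equiv.prodComm (Fin 2) (Fin 2))).trans
        (Equiv.prodAssoc β (Fin 2) (Fin 2)).symm))).trans
    (Equiv.sumProdDistrib α (β × Fin 2) (Fin 2)).symm

/-- The permutation of `V × Fin 2` which, up to the labellings `π` of positions and `τ` of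
variables, puts the slots `(b, 0), (b, 1)` of the `δ'` factors in the positions `(b, 1)`, and
arranges the remaining slots according to `ρ`. -/
def assemble (π τ : (α ⊕ β × Fin 2) ≃ V) (ρ : Equiv.Perm ((α ⊕ β) × Fin 2)) :
    Equiv.Perm (V × Fin 2) :=
  (π.prodCongr (Equiv.refl (Fin 2))).symm.trans
    ((((positionEquiv α β).trans (Equiv.Perm.sumCongr ρ 1)).trans (positionEquiv α β).symm).trans
      ((twist α β).trans (τ.prodCongr (Equiv.refl (Fin 2)))))

/-- The slot of `V × Fin 2` with a given reduced label: of the two variables that a `δ'` factor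
identifies, the first supplies the row `0` and the second the row `1`. -/
def slot (τ : (α ⊕ β × Fin 2) ≃ V) : (α ⊕ β) × Fin 2 → V × Fin 2
  | (Sum.inl a, s) => (τ (Sum.inl a), s)
  | (Sum.inr b, s) => (τ (Sum.inr (b, s)), 0)

/-- The inclusion of the reduced positions in all positions. -/
def keep : α ⊕ β → α ⊕ β × Fin 2
  | Sum.inl a => Sum.inl a
  | Sum.inr b => Sum.inr (b, 0)

lemma slot_injective (τ : (α ⊕ β × Fin 2) ≃ V) : Function.Injective (slot τ) := by
  rintro ⟨a | b, s⟩ ⟨a' | b', s'⟩ h <;> simp_all [slot]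

lemma assemble_keep (π τ : (α ⊕ β × Fin 2) ≃ V) (ρ : Equiv.Perm ((α ⊕ β) × Fin 2))
    (l : α ⊕ β) (s : Fin 2) : assemble π τ ρ (π (keep l), s) = slot τ (ρ (l, s)) := by
  have h_slot : ∀ q : (α ⊕ β) × Fin 2, (τ.prodCongr (Equiv.refl (Fin 2)))
      (twist α β ((positionEquiv α β).symm (Sum.inl q))) = slot τ q := by
    rintro ⟨a | b, s⟩ <;> rfl
  rw [← h_slot]
  rcases l with a | b <;> simp [assemble, keep, positionEquiv]

lemma assemble_inr_one (π τ : (α ⊕ β × Fin 2) ≃ V) (ρ : Equiv.Perm ((α ⊕ β) × Fin 2))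
    (b : β) (s : Fin 2) :
    assemble π τ ρ (π (Sum.inr (b, 1)), s) = (τ (Sum.inr (b, s)), 1) := by
  simp [assemble, positionEquiv, twist]

lemma assemble_injective (π τ : (α ⊕ β × Fin 2) ≃ V) :
    Function.Injective (assemble π τ) := by
  intro ρ ρ' h
  ext1 ⟨l, s⟩
  exact slot_injective τ (by rw [← assemble_keep π τ ρ, ← assemble_keep π τ ρ', h])

lemma exists_sumCongr_one_eq {γ δ : Type*} [Finite γ] [Finite δ] (ξ : Equiv.Perm (γ ⊕ δ))
    (hξ : ∀ d, ξ (Sum.inr d) = Sum.inr d) : ∃ ρ, Equiv.Perm.sumCongr ρ 1 = ξ := by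
  obtain ⟨⟨ρ, ρ'⟩, rfl⟩ := Equiv.Perm.mem_sumCongrHom_range_of_perm_mapsTo_inl
    ((Equiv.Perm.perm_mapsTo_inl_iff_mapsTo_inr ξ).2 (by
      rintro _ ⟨d, rfl⟩; exact ⟨d, (hξ d).symm⟩))
  obtain rfl : ρ' = 1 := Equiv.ext fun d => Sum.inr_injective (hξ d)
  exact ⟨ρ, rfl⟩

lemma exists_assemble_eq [Finite α] [Finite β] (π τ : (α ⊕ β × Fin 2) ≃ V)
    (σ : Equiv.Perm (V × Fin 2))
    (hσ : ∀ b s, σ (π (Sum.inr (b, 1)), s) = (τ (Sum.inr (b, s)), 1)) :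
    ∃ ρ, assemble π τ ρ = σ := by
  obtain ⟨ρ, hρ⟩ := exists_sumCongr_one_eq
    ((positionEquiv α β).symm.trans (((π.prodCongr (Equiv.refl (Fin 2))).trans
      (σ.trans ((τ.prodCongr (Equiv.refl (Fin 2))).symm.trans (twist α β).symm))).trans
        (positionEquiv α β))) (by
      rintro ⟨b, s⟩
      have h_twist : (twist α β).symm (Sum.inr (b, s), 1) = (Sum.inr (b, 1), s) := rfl
      simp [positionEquiv, hσ, h_twist])
  refine ⟨ρ, ?_⟩
  ext1 ⟨v, s⟩
  simp [assemble, hρ, Prod.map]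

variable [Fintype α] [DecidableEq α] [Fintype β] [DecidableEq β]

lemma sign_twist : Equiv.Perm.sign (twist α β) = (-1) ^ Fintype.card β := by
  have h_swap :
      Equiv.Perm.sign (Equiv.prodComm (Fin 2) (Fin 2) : Equiv.Perm (Fin 2 × Fin 2)) = -1 := by
    decide
  rw [twist, Equiv.Perm.sign_trans_trans_symm, Equiv.Perm.sign_sumCongr,
    Equiv.Perm.sign_trans_trans_symm, Equiv.Perm.sign_prodCongrRight, map_one, one_mul]
  simp only [h_swap, Finset.prod_const, Finset.card_univ]

/-- Changing the labellings acts in the same way on both rows of each block, so it does not change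
the sign. -/
lemma sign_assemble [Fintype V] [DecidableEq V] (π τ : (α ⊕ β × Fin 2) ≃ V)
    (ρ : Equiv.Perm ((α ⊕ β) × Fin 2)) :
    Equiv.Perm.sign (assemble π τ ρ) = (-1) ^ Fintype.card β * Equiv.Perm.sign ρ := by
  have h_conj : assemble π τ ρ = ((π.prodCongr (Equiv.refl (Fin 2))).symm.trans
      ((((((positionEquiv α β).trans (Equiv.Perm.sumCongr ρ 1)).trans
        (positionEquiv α β).symm).trans (twist α β))).trans
          (Equiv.prodCongrLeft fun _ : Fin 2 => (τ.trans π.symm : Equiv.Perm _)))).trans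
            (π.prodCongr (Equiv.refl (Fin 2))) := by
    ext q : 1
    simp only [assemble, Equiv.trans_apply]
    generalize twist α β _ = t
    simp [Prod.map, Equiv.prodCongrLeft]
  rw [h_conj, Equiv.Perm.sign_symm_trans_trans, Equiv.Perm.sign_trans, Equiv.Perm.sign_trans,
    Equiv.Perm.sign_trans_trans_symm, Equiv.Perm.sign_prodCongrLeft, sign_twist,
    Equiv.Perm.sign_sumCongr]
  simp

end Assemble

/-! ### Monomials of a Pfaffian and their derivatives -/

section Monomial

variable {κ V W : Type*}

/-- The entry of the block matrix `K (x v) (x w)` in the row `p` and the column `q`, where `(v, s)`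
stands for the row or column `s` of the block `v`. -/
def slotEntry (K : Kernel) (x : V → ℝ) (p q : V × Fin 2) : ℝ :=
  K (x p.1) (x q.1) p.2 q.2

/-- The monomial of a Pfaffian whose `l`-th factor is the entry in the row `f (l, 0)` and the
column `f (l, 1)`. -/
def slotMonomial [Fintype κ] (K : Kernel) (f : κ × Fin 2 → V × Fin 2) (x : V → ℝ) : ℝ :=
  ∏ l : κ, slotEntry K x (f (l, 0)) (f (l, 1))

/-- A differentiable kernel whose second row (column) is the negative of the derivative of the
first. -/
structure IsDerivKernel (K : Kernel) : Prop where
  differentiable : ∀ s t, Differentiable ℝ fun p : ℝ × ℝ => K p.1 p.2 s t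
  hasDerivAt_left : ∀ x y t, HasDerivAt (fun u => K u y 0 t) (-K x y 1 t) x
  hasDerivAt_right : ∀ x y s, HasDerivAt (fun u => K x u s 0) (-K x y s 1) y

lemma slotMonomial_comp [Fintype κ] (K : Kernel) (f : κ × Fin 2 → V × Fin 2) (c : V → W)
    (z : W → ℝ) :
    slotMonomial K f (fun v => z (c v)) = slotMonomial K (fun q => (c (f q).1, (f q).2)) z :=
  rfl

lemma hasDerivAt_prod_of_forall_ne_const [Fintype κ] [DecidableEq κ] {g : κ → ℝ → ℝ} {l : κ}
    {g' x : ℝ} (hg : HasDerivAt (g l) g' x) (hconst : ∀ l' ≠ l, ∀ u, g l' u = g l' x) :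
    HasDerivAt (fun u => ∏ l', g l' u) (g' * ∏ l' ∈ Finset.univ.erase l, g l' x) x := by
  have h_split : (fun u => ∏ l', g l' u) =
      fun u => g l u * ∏ l' ∈ Finset.univ.erase l, g l' x := by
    ext u
    rw [← Finset.mul_prod_erase _ _ (Finset.mem_univ l)]
    exact congrArg _ (Finset.prod_congr rfl fun l' hl' => hconst l' (Finset.ne_of_mem_erase hl') u)
  exact h_split ▸ hg.mul_const _

lemma slotMonomial_update [Fintype κ] [DecidableEq κ] (K : Kernel) (f : κ × Fin 2 → V × Fin 2)
    (l : κ) (s : Fin 2) (r : V × Fin 2) (x : V → ℝ) :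
    slotMonomial K (Function.update f (l, s) r) x =
      slotEntry K x (Function.update f (l, s) r (l, 0)) (Function.update f (l, s) r (l, 1)) *
        ∏ l' ∈ Finset.univ.erase l, slotEntry K x (f (l', 0)) (f (l', 1)) := by
  rw [slotMonomial, ← Finset.mul_prod_erase _ _ (Finset.mem_univ l)]
  congr 1
  refine Finset.prod_congr rfl fun l' hl' => ?_
  have hl : l' ≠ l := Finset.ne_of_mem_erase hl'
  rw [Function.update_of_ne (by simp [hl]), Function.update_of_ne (by simp [hl])]

lemma slotEntry_update_of_ne [DecidableEq V] (K : Kernel) {p q : V × Fin 2} {v : V}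
    (hp : p.1 ≠ v) (hq : q.1 ≠ v) (x : V → ℝ) (u : ℝ) :
    slotEntry K (Function.update x v u) p q = slotEntry K x p q := by
  rw [slotEntry, slotEntry, Function.update_of_ne hp, Function.update_of_ne hq]

namespace IsDerivKernel

variable {K : Kernel}

lemma neg (hK : IsDerivKernel K) : IsDerivKernel (-K) where
  differentiable s t := (hK.differentiable s t).neg
  hasDerivAt_left x y t := (hK.hasDerivAt_left x y t).neg
  hasDerivAt_right x y s := (hK.hasDerivAt_right x y s).neg

lemma differentiable_slotMonomial [Fintype κ] [Finite V] (hK : IsDerivKernel K)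
    (f : κ × Fin 2 → V × Fin 2) : Differentiable ℝ (slotMonomial K f) := by
  classical
  have := Fintype.ofFinite V
  have h_entry : ∀ l, Differentiable ℝ fun x => slotEntry K x (f (l, 0)) (f (l, 1)) := fun l =>
    (hK.differentiable (f (l, 0)).2 (f (l, 1)).2).comp
      ((differentiable_apply (f (l, 0)).1).prodMk (differentiable_apply (f (l, 1)).1))
  exact fun x => (HasFDerivAt.finsetProd fun l _ => (h_entry l x).hasFDerivAt).differentiableAt

variable [DecidableEq V]

lemma hasDerivAt_slotEntry_left (hK : IsDerivKernel K) {v : V} {q : V × Fin 2} (hq : q.1 ≠ v)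
    (x : V → ℝ) : HasDerivAt (fun u => slotEntry K (Function.update x v u) (v, 0) q)
      (-slotEntry K x (v, 1) q) (x v) := by
  simpa [slotEntry, Function.update_of_ne hq] using hK.hasDerivAt_left (x v) (x q.1) q.2

lemma hasDerivAt_slotEntry_right (hK : IsDerivKernel K) {v : V} {p : V × Fin 2} (hp : p.1 ≠ v)
    (x : V → ℝ) : HasDerivAt (fun u => slotEntry K (Function.update x v u) p (v, 0))
      (-slotEntry K x p (v, 1)) (x v) := by
  simpa [slotEntry, Function.update_of_ne hp] using hK.hasDerivAt_right (x p.1) (x v) p.2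

variable [Fintype κ] [DecidableEq κ]

lemma hasDerivAt_slotMonomial (hK : IsDerivKernel K) (f : κ × Fin 2 → V × Fin 2)
    {q : κ × Fin 2} {v : V} (hq : f q = (v, 0)) (hne : ∀ q' ≠ q, (f q').1 ≠ v) (x : V → ℝ) :
    HasDerivAt (fun u => slotMonomial K f (Function.update x v u))
      (-slotMonomial K (Function.update f q (v, 1)) x) (x v) := by
  obtain ⟨l, s⟩ := q
  have h_entry : HasDerivAt
      (fun u => slotEntry K (Function.update x v u) (f (l, 0)) (f (l, 1)))
      (-slotEntry K x (Function.update f (l, s) (v, 1) (l, 0))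
        (Function.update f (l, s) (v, 1) (l, 1))) (x v) := by
    obtain rfl | rfl : s = 0 ∨ s = 1 := by fin_cases s <;> simp
    · simpa [hq] using hK.hasDerivAt_slotEntry_left (hne (l, 1) (by simp)) x
    · simpa [hq] using hK.hasDerivAt_slotEntry_right (hne (l, 0) (by simp)) x
  have h_const : ∀ l' ≠ l, ∀ u, slotEntry K (Function.update x v u) (f (l', 0)) (f (l', 1)) =
      slotEntry K x (f (l', 0)) (f (l', 1)) := fun l' hl' u =>
    slotEntry_update_of_ne K (hne _ (by simp [hl'])) (hne _ (by simp [hl'])) x u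
  have h := hasDerivAt_prod_of_forall_ne_const
    (g := fun l' u => slotEntry K (Function.update x v u) (f (l', 0)) (f (l', 1))) h_entry
    (by simpa using h_const)
  simp only [Function.update_eq_self] at h
  rwa [slotMonomial_update, ← neg_mul]

lemma fderiv_slotMonomial_single [Finite V] (hK : IsDerivKernel K) (f : κ × Fin 2 → V × Fin 2)
    {q : κ × Fin 2} {v : V} (hq : f q = (v, 0)) (hne : ∀ q' ≠ q, (f q').1 ≠ v) (x : V → ℝ) :
    fderiv ℝ (slotMonomial K f) x (Pi.single v 1) =
      -slotMonomial K (Function.update f q (v, 1)) x := by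
  have := Fintype.ofFinite V
  have h_chain := (hK.differentiable_slotMonomial f).differentiableAt.hasFDerivAt.comp_hasDerivAt
    (x v) (hasDerivAt_update x v (x v))
  rw [Function.update_eq_self] at h_chain
  exact h_chain.unique (hK.hasDerivAt_slotMonomial f hq hne x)

end IsDerivKernel

end Monomial

/-! ### The action of `δ'` on a monomial -/

section DeltaPrime

variable {α β : Type*} {V : Type}

/-- The pair of variables of the `δ'` factor with label `b`. -/
def deltaPair (τ : (α ⊕ β × Fin 2) ≃ V) (b : β) : V × V :=
  (τ (Sum.inr (b, 0)), τ (Sum.inr (b, 1)))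

/-- As `slot`, but the slots over `D` are differentiated: they have the row `1`. -/
def diffSlot [DecidableEq β] (τ : (α ⊕ β × Fin 2) ≃ V) (D : Finset (β × Fin 2)) :
    (α ⊕ β) × Fin 2 → V × Fin 2
  | (Sum.inl a, s) => (τ (Sum.inl a), s)
  | (Sum.inr b, s) => (τ (Sum.inr (b, s)), if (b, s) ∈ D then 1 else 0)

/-- The slots differentiated by the term of `∏_{b ∈ L} (∂_{(b, 1)} - ∂_{(b, 0)})` in which the
derivative with respect to `(b, 1)` is chosen for `b ∈ U`. -/
def chosenSlots [DecidableEq β] (L U : Finset β) : Finset (β × Fin 2) :=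
  L.image fun b => (b, if b ∈ U then 1 else 0)

/-- Exchanges the slots `(b, 0)` and `(b, 1)` for `b ∉ U`. -/
def flip (α : Type*) [DecidableEq β] (U : Finset β) : Equiv.Perm ((α ⊕ β) × Fin 2) :=
  Equiv.prodCongrRight fun
    | Sum.inl _ => 1
    | Sum.inr b => if b ∈ U then 1 else Equiv.swap 0 1

/-- The reduced label of a variable. -/
def collapse : α ⊕ β × Fin 2 → α ⊕ β
  | Sum.inl a => Sum.inl a
  | Sum.inr (b, _) => Sum.inr b

lemma collapse_keep (q : α ⊕ β) : collapse (keep q) = q := by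
  rcases q with a | b <;> rfl

section ChosenSlots

variable [DecidableEq β] {L U : Finset β} {b : β}

lemma diffSlot_empty (τ : (α ⊕ β × Fin 2) ≃ V) : diffSlot τ ∅ = slot τ := by
  ext1 ⟨a | b, s⟩ <;> simp [diffSlot, slot]

lemma diffSlot_insert [DecidableEq α] (τ : (α ⊕ β × Fin 2) ≃ V) (D : Finset (β × Fin 2)) (b : β)
    (s : Fin 2) :
    diffSlot τ (insert (b, s) D) =
      Function.update (diffSlot τ D) (Sum.inr b, s) (τ (Sum.inr (b, s)), 1) := by
  ext1 ⟨a | b', s'⟩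
  · rw [Function.update_of_ne (by simp)]; rfl
  · by_cases h : (b', s') = (b, s)
    · obtain ⟨rfl, rfl⟩ := Prod.mk_inj.1 h
      simp [diffSlot]
    · rw [Function.update_of_ne (by simpa using h)]
      simp only [diffSlot, Finset.mem_insert, h, false_or]

lemma mem_chosenSlots {s : Fin 2} :
    (b, s) ∈ chosenSlots L U ↔ b ∈ L ∧ s = if b ∈ U then 1 else 0 := by
  simp [chosenSlots, eq_comm]

lemma chosenSlots_insert_left (hbU : b ∉ U) :
    chosenSlots (insert b L) U = insert (b, 0) (chosenSlots L U) := by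
  rw [chosenSlots, Finset.image_insert, if_neg hbU, chosenSlots]

lemma chosenSlots_insert_insert (hb : b ∉ L) :
    chosenSlots (insert b L) (insert b U) = insert (b, 1) (chosenSlots L U) := by
  rw [chosenSlots, Finset.image_insert, if_pos (Finset.mem_insert_self b U), chosenSlots]
  congr 1
  refine Finset.image_congr fun b' hb' => ?_
  have hne : b' ≠ b := fun h => hb (h ▸ hb')
  simp only [Finset.mem_insert, hne, false_or]

lemma collapse_diffSlot_univ [Fintype β] (τ : (α ⊕ β × Fin 2) ≃ V) (U : Finset β)
    (q : (α ⊕ β) × Fin 2) :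
    (collapse (τ.symm (diffSlot τ (chosenSlots Finset.univ U) q).1),
      (diffSlot τ (chosenSlots Finset.univ U) q).2) = flip α U q := by
  rcases q with ⟨a | b, s⟩
  · simp [diffSlot, flip, collapse]
  · by_cases hb : b ∈ U <;> fin_cases s <;> simp [diffSlot, flip, collapse, mem_chosenSlots, hb]

end ChosenSlots

lemma sign_flip [Fintype α] [DecidableEq α] [Fintype β] [DecidableEq β] (U : Finset β) :
    Equiv.Perm.sign (flip α U) = (-1) ^ (Fintype.card β + U.card) := by
  have h_fiber : ∀ b : β, Equiv.Perm.sign (if b ∈ U then 1 else Equiv.swap (0 : Fin 2) 1) =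
      -1 * (if b ∈ U then (-1 : ℤˣ) else 1) := by
    intro b; split_ifs <;> simp
  rw [flip, Equiv.Perm.sign_prodCongrRight, Fintype.prod_sum_type]
  simp only [map_one, Finset.prod_const_one, one_mul, h_fiber, Finset.prod_mul_distrib,
    Finset.prod_const, Finset.card_univ, pow_add, Finset.prod_ite_mem, Finset.univ_inter]

section Identify

variable [DecidableEq V] (τ : (α ⊕ β × Fin 2) ≃ V)

lemma identify_map_deltaPair [DecidableEq α] [DecidableEq β] (L : List β) (t : α ⊕ β × Fin 2) :
    identify (L.map (deltaPair τ)) (τ t) =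
      if ∃ b ∈ L, t = Sum.inr (b, 1) then τ (keep (collapse t)) else τ t := by
  induction L with
  | nil => simp [identify]
  | cons b L ih =>
    simp only [identify, List.map_cons, List.foldr_cons] at ih ⊢
    rw [Function.update_apply, ih]
    by_cases h : t = Sum.inr (b, 1)
    · subst h
      simp [deltaPair, keep, collapse]
    · have h' : τ t ≠ (deltaPair τ b).2 := by simpa [deltaPair] using h
      simp [h', h]

variable {L : List β} (hL : ∀ b, b ∈ L)

include hL in
lemma identify_map_deltaPair_of_forall_mem (t : α ⊕ β × Fin 2) :
    identify (L.map (deltaPair τ)) (τ t) = τ (keep (collapse t)) := by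
  classical
  rw [identify_map_deltaPair]
  rcases t with a | ⟨b, s⟩
  · simp [keep, collapse]
  · fin_cases s <;> simp [keep, collapse, hL]

/-- The bijection between the reduced labels and the variables which remain after the action of
the `δ'` factors. -/
def keepEquiv : α ⊕ β ≃ Set.range (identify (L.map (deltaPair τ))) where
  toFun q := Set.rangeFactorization _ (τ (keep q))
  invFun v := collapse (τ.symm v)
  left_inv q := by
    simp [Set.rangeFactorization, identify_map_deltaPair_of_forall_mem τ hL, collapse_keep]
  right_inv := by
    rintro ⟨_, v, rfl⟩
    obtain ⟨t, rfl⟩ := τ.surjective v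
    simp [Set.rangeFactorization, identify_map_deltaPair_of_forall_mem τ hL, collapse_keep]

lemma rangeFactorization_identify_eq (v : V) :
    Set.rangeFactorization (identify (L.map (deltaPair τ))) v =
      keepEquiv τ hL (collapse (τ.symm v)) := by
  obtain ⟨t, rfl⟩ := τ.surjective v
  apply Subtype.ext
  simp [keepEquiv, Set.rangeFactorization, identify_map_deltaPair_of_forall_mem τ hL,
    collapse_keep]

end Identify

namespace IsDerivKernel

variable {K : Kernel} [Fintype α] [Fintype β] [DecidableEq β] [DecidableEq V]

lemma fderiv_slotMonomial_diffSlot [Finite V] (hK : IsDerivKernel K)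
    (τ : (α ⊕ β × Fin 2) ≃ V) (ρ : Equiv.Perm ((α ⊕ β) × Fin 2)) {D : Finset (β × Fin 2)}
    {b : β} {s : Fin 2} (hb : (b, s) ∉ D) (x : V → ℝ) :
    fderiv ℝ (slotMonomial K (diffSlot τ D ∘ ρ)) x (Pi.single (τ (Sum.inr (b, s))) 1) =
      -slotMonomial K (diffSlot τ (insert (b, s) D) ∘ ρ) x := by
  classical
  have h_insert : diffSlot τ (insert (b, s) D) ∘ ρ = Function.update (diffSlot τ D ∘ ρ)
      (ρ.symm (Sum.inr b, s)) (τ (Sum.inr (b, s)), 1) := by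
    rw [diffSlot_insert, Function.update_comp_equiv]
  rw [h_insert]
  refine hK.fderiv_slotMonomial_single _ (by simp [diffSlot, hb]) (fun q' hq' => ?_) x
  have hq : ρ q' ≠ (Sum.inr b, s) := by rwa [Ne, ← Equiv.eq_symm_apply]
  rw [Function.comp_apply]
  generalize ρ q' = p at hq
  rcases p with ⟨a' | b', s'⟩
  · simp [diffSlot]
  · simpa [diffSlot] using hq

lemma fderiv_slotMonomial_chosenSlots [Finite V] (hK : IsDerivKernel K)
    (τ : (α ⊕ β × Fin 2) ≃ V) (ρ : Equiv.Perm ((α ⊕ β) × Fin 2)) {L U : Finset β} {b : β}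
    (hb : b ∉ L) (hU : U ⊆ L) (x : V → ℝ) :
    fderiv ℝ (slotMonomial K (diffSlot τ (chosenSlots L U) ∘ ρ)) x
        (Pi.single (deltaPair τ b).2 1 - Pi.single (deltaPair τ b).1 1) =
      slotMonomial K (diffSlot τ (chosenSlots (insert b L) U) ∘ ρ) x -
        slotMonomial K (diffSlot τ (chosenSlots (insert b L) (insert b U)) ∘ ρ) x := by
  have h_notMem : ∀ s : Fin 2, (b, s) ∉ chosenSlots L U := fun s h => hb (mem_chosenSlots.1 h).1
  rw [map_sub, deltaPair, hK.fderiv_slotMonomial_diffSlot τ ρ (h_notMem 0),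
    hK.fderiv_slotMonomial_diffSlot τ ρ (h_notMem 1), chosenSlots_insert_left (fun h => hb (hU h)),
    chosenSlots_insert_insert hb]
  ring

variable [Fintype V]

lemma deltaPrimeDeriv_slotMonomial (hK : IsDerivKernel K) (τ : (α ⊕ β × Fin 2) ≃ V)
    (ρ : Equiv.Perm ((α ⊕ β) × Fin 2)) (c : ℝ) {L : List β} (hL : L.Nodup) :
    deltaPrimeDeriv (L.map (deltaPair τ)) (fun x => c * slotMonomial K (slot τ ∘ ρ) x) =
      fun x => c * ∑ U ∈ L.toFinset.powerset,
        (-1) ^ U.card * slotMonomial K (diffSlot τ (chosenSlots L.toFinset U) ∘ ρ) x := by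
  classical
  induction L with
  | nil => simp [deltaPrimeDeriv, chosenSlots, diffSlot_empty]
  | cons b L ih =>
    obtain ⟨hb, hL⟩ := List.nodup_cons.1 hL
    have hbL : b ∉ L.toFinset := by simpa using hb
    specialize ih hL
    simp only [deltaPrimeDeriv, List.map_cons, List.foldr_cons] at ih ⊢
    rw [ih]
    ext1 x
    have h_fderiv : HasFDerivAt (fun x => c * ∑ U ∈ L.toFinset.powerset,
        (-1) ^ U.card * slotMonomial K (diffSlot τ (chosenSlots L.toFinset U) ∘ ρ) x)
        (c • ∑ U ∈ L.toFinset.powerset, ((-1 : ℝ) ^ U.card •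
          fderiv ℝ (slotMonomial K (diffSlot τ (chosenSlots L.toFinset U) ∘ ρ)) x)) x :=
      (HasFDerivAt.fun_sum fun U _ =>
        (hK.differentiable_slotMonomial _ x).hasFDerivAt.const_mul _).const_mul c
    rw [h_fderiv.differentiableAt.lineDeriv_eq_fderiv, h_fderiv.fderiv, List.toFinset_cons,
      Finset.sum_powerset_insert hbL, ← Finset.sum_add_distrib]
    simp only [smul_apply, sum_apply, smul_eq_mul]
    congr 1
    refine Finset.sum_congr rfl fun U hU => ?_
    have hUL := Finset.mem_powerset.1 hU
    rw [hK.fderiv_slotMonomial_chosenSlots τ ρ hbL hUL,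
      Finset.card_insert_of_notMem fun h => hbL (hUL h)]
    ring

/-- On the diagonals, differentiating the second variable of a `δ'` factor leaves the two merged
slots as they are, and differentiating the first one exchanges them. -/
lemma deltaPrimeIntegrand_slotMonomial (hK : IsDerivKernel K) (τ : (α ⊕ β × Fin 2) ≃ V)
    (ρ : Equiv.Perm ((α ⊕ β) × Fin 2)) (c : ℝ) {L : List β} (hL : L.Nodup) (hL' : ∀ b, b ∈ L)
    (y : Set.range (identify (L.map (deltaPair τ))) → ℝ) :
    deltaPrimeIntegrand (L.map (deltaPair τ)) (fun x => c * slotMonomial K (slot τ ∘ ρ) x) y =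
      c * ∑ U : Finset β, (-1) ^ U.card *
        slotMonomial K (flip α U * ρ) (fun q => y (keepEquiv τ hL' q)) := by
  have hLu : L.toFinset = Finset.univ := by ext b; simp [hL']
  rw [deltaPrimeIntegrand, hK.deltaPrimeDeriv_slotMonomial τ ρ c hL, hLu, Finset.powerset_univ]
  simp only [rangeFactorization_identify_eq τ hL']
  congr 1
  refine Finset.sum_congr rfl fun U _ => ?_
  rw [slotMonomial_comp K _ (fun v => collapse (τ.symm v)) (fun q => y (keepEquiv τ hL' q))]
  congr 2
  exact funext fun q => collapse_diffSlot_univ τ U (ρ q)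

end IsDerivKernel

end DeltaPrime

/-! ### Integrals over products of copies of a set -/

section Pi

variable {κ ι X E : Type*}

lemma measurableEquiv_piCongrLeft_symm_apply [MeasurableSpace X] (e : κ ≃ ι) (y : ι → X) :
    MeasurableEquiv.piCongrLeft (fun _ : κ => X) e.symm y = fun q => y (e q) := by
  ext1 q
  rw [MeasurableEquiv.coe_piCongrLeft]
  simpa using Equiv.piCongrLeft_apply_apply (fun _ : κ => X) e.symm y (e q)

lemma preimage_piCongrLeft_symm_pi [MeasurableSpace X] (e : κ ≃ ι) (S : Set X) :
    MeasurableEquiv.piCongrLeft (fun _ : κ => X) e.symm ⁻¹' Set.univ.pi (fun _ => S) =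
      Set.univ.pi (fun _ => S) := by
  ext y
  simp only [Set.mem_preimage, measurableEquiv_piCongrLeft_symm_apply, Set.mem_univ_pi]
  exact e.forall_congr_left.trans (by simp)

variable [Fintype κ] [MeasureSpace X] [SigmaFinite (volume : Measure X)]

lemma restrict_volume_pi (S : Set X) :
    (volume : Measure (κ → X)).restrict (Set.univ.pi fun _ => S) =
      Measure.pi fun _ => volume.restrict S := by
  rw [volume_pi, Measure.restrict_pi_pi]

variable [Fintype ι] [NormedAddCommGroup E]

lemma setIntegral_pi_comp_equiv [NormedSpace ℝ E] (e : κ ≃ ι) (S : Set X) (g : (κ → X) → E) :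
    ∫ y in Set.univ.pi (fun _ : ι => S), g (fun q => y (e q)) =
      ∫ z in Set.univ.pi (fun _ : κ => S), g z := by
  have h := volume_measurePreserving_piCongrLeft (fun _ : κ => X) e.symm
  rw [← h.setIntegral_preimage_emb (MeasurableEquiv.measurableEmbedding _) g,
    preimage_piCongrLeft_symm_pi]
  simp only [measurableEquiv_piCongrLeft_symm_apply]

lemma integrableOn_pi_comp_equiv (e : κ ≃ ι) {S : Set X} {g : (κ → X) → E}
    (hg : IntegrableOn g (Set.univ.pi fun _ => S)) :
    IntegrableOn (fun y : ι → X => g (fun q => y (e q))) (Set.univ.pi fun _ => S) := by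
  have h := ((volume_measurePreserving_piCongrLeft (fun _ : κ => X)
    e.symm).integrableOn_comp_preimage (MeasurableEquiv.measurableEmbedding _)
      (s := Set.univ.pi fun _ => S)).2 hg
  rw [preimage_piCongrLeft_symm_pi] at h
  simpa only [Function.comp_def, measurableEquiv_piCongrLeft_symm_apply] using h

end Pi

/-! ### Bounds for Pfaffians -/

section Bound

variable {κ : Type*} [Fintype κ]

lemma abs_det_le_prod_sqrt_sum_sq [DecidableEq κ] (N : Matrix κ κ ℝ) :
    |N.det| ≤ ∏ i, √(∑ j, N i j ^ 2) := by
  let e := Fintype.equivFin κ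
  let rows : Fin (Fintype.card κ) → EuclideanSpace ℝ (Fin (Fintype.card κ)) :=
    fun i => WithLp.toLp 2 (Matrix.reindex e e N i)
  let b := EuclideanSpace.basisFun (Fin (Fintype.card κ)) ℝ
  have : Fact (Module.finrank ℝ (EuclideanSpace ℝ (Fin (Fintype.card κ))) = Fintype.card κ) :=
    ⟨by simp⟩
  have h_volume := b.toBasis.orientation.abs_volumeForm_apply_le rows
  have h_rows : b.toBasis.toMatrix rows = (Matrix.reindex e e N).transpose := by
    ext i j
    simp [Module.Basis.toMatrix_apply, b, rows]
  rw [Orientation.volumeForm_robust _ b rfl, Module.Basis.det_apply, h_rows,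
    Matrix.det_transpose, Matrix.det_reindex_self] at h_volume
  refine h_volume.trans_eq ((Fintype.prod_equiv e _ _ fun i => ?_).symm)
  simp [rows, EuclideanSpace.norm_eq, e.symm.sum_comp fun j => N i j ^ 2]

lemma abs_det_le_of_abs_le_mul [DecidableEq κ] {N : Matrix κ κ ℝ} {u v : κ → ℝ}
    (hu : ∀ i, 0 ≤ u i) (hv : ∀ j, 0 ≤ v j) (hN : ∀ i j, |N i j| ≤ u i * v j) :
    |N.det| ≤ ((∏ i, u i) * ∏ j, v j) * √(Fintype.card κ) ^ Fintype.card κ := by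
  let N' : Matrix κ κ ℝ := Matrix.of fun i j => N i j / (u i * v j)
  have h_scale : N = Matrix.of fun i j => v j * (Matrix.of fun i j => u i * N' i j) i j := by
    ext i j
    rcases eq_or_ne (u i * v j) 0 with h | h
    · have h_zero : N i j = 0 := abs_nonpos_iff.1 (h ▸ hN i j)
      simp [N', h_zero]
    · simp only [N', Matrix.of_apply]
      rw [← mul_assoc, mul_comm (v j), mul_div_cancel₀ _ h]
  have h_entry : ∀ i j, N' i j ^ 2 ≤ 1 := fun i j => by
    rw [sq_le_one_iff_abs_le_one]
    simp only [N', Matrix.of_apply]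
    rw [abs_div, abs_of_nonneg (mul_nonneg (hu i) (hv j))]
    exact div_le_one_of_le₀ (hN i j) (mul_nonneg (hu i) (hv j))
  have h_det : |N'.det| ≤ √(Fintype.card κ) ^ Fintype.card κ := by
    refine (abs_det_le_prod_sqrt_sum_sq N').trans ?_
    rw [← Finset.card_univ, ← Finset.prod_const]
    refine Finset.prod_le_prod (fun _ _ => Real.sqrt_nonneg _) fun i _ => Real.sqrt_le_sqrt ?_
    simpa using Finset.sum_le_sum fun j (_ : j ∈ Finset.univ) => h_entry i j
  rw [h_scale, Matrix.det_mul_row, Matrix.det_mul_column, abs_mul, abs_mul,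
    abs_of_nonneg (Finset.prod_nonneg fun i _ => hu i),
    abs_of_nonneg (Finset.prod_nonneg fun j _ => hv j), ← mul_assoc, mul_comm (∏ j, v j)]
  exact mul_le_mul_of_nonneg_left h_det (mul_nonneg (Finset.prod_nonneg fun i _ => hu i)
    (Finset.prod_nonneg fun j _ => hv j))

lemma prod_perm_mul_prod_perm {M : Type*} [CommMonoid M] (ρ : Equiv.Perm (κ × Fin 2))
    (f : κ × Fin 2 → M) : ∏ l, (f (ρ (l, 0)) * f (ρ (l, 1))) = ∏ q, (f (q, 0) * f (q, 1)) := by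
  simpa only [Fintype.prod_prod_type, Fin.prod_univ_two] using Equiv.prod_comp ρ f

variable {k : ℕ} {M : Matrix (Fin k × Fin 2) (Fin k × Fin 2) ℝ}

/-- Permuting the first entries of the `k` pairs among themselves permutes the summands of the
Pfaffian; averaging over these permutations turns the products into determinants. -/
lemma factorial_mul_sum_perm_eq (M : Matrix (Fin k × Fin 2) (Fin k × Fin 2) ℝ) :
    (k ! : ℝ) * ∑ σ : Equiv.Perm (Fin k × Fin 2),
        ((Equiv.Perm.sign σ : ℤ) : ℝ) * ∏ l : Fin k, M (σ (l, 0)) (σ (l, 1)) =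
      ∑ σ : Equiv.Perm (Fin k × Fin 2), ((Equiv.Perm.sign σ : ℤ) : ℝ) *
        (Matrix.of fun i j => M (σ (i, 0)) (σ (j, 1))).det := by
  have h_permute : ∀ ρ : Equiv.Perm (Fin k), ∑ σ : Equiv.Perm (Fin k × Fin 2),
        ((Equiv.Perm.sign σ : ℤ) : ℝ) * ∏ l : Fin k, M (σ (l, 0)) (σ (l, 1)) =
      ∑ σ : Equiv.Perm (Fin k × Fin 2), ((Equiv.Perm.sign σ : ℤ) : ℝ) *
        (((Equiv.Perm.sign ρ : ℤ) : ℝ) * ∏ l : Fin k, M (σ (ρ l, 0)) (σ (l, 1))) := by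
    intro ρ
    let r : Equiv.Perm (Fin k × Fin 2) := Equiv.prodCongrLeft fun s => if s = 0 then ρ else 1
    have h_sign : Equiv.Perm.sign r = Equiv.Perm.sign ρ := by
      simp [r, Equiv.Perm.sign_prodCongrLeft]
    rw [← Equiv.sum_comp (Equiv.mulRight r)]
    refine Finset.sum_congr rfl fun σ _ => ?_
    simp [h_sign, r, mul_assoc]
  have h_card : (k ! : ℝ) = ∑ _ρ : Equiv.Perm (Fin k), (1 : ℝ) := by
    simp [Fintype.card_perm]
  rw [h_card, Finset.sum_mul]
  simp only [one_mul]
  rw [Finset.sum_congr rfl fun ρ _ => h_permute ρ, Finset.sum_comm]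
  refine Finset.sum_congr rfl fun σ _ => ?_
  rw [← Finset.mul_sum, Matrix.det_apply']
  rfl

lemma factorial_two_mul_le_four_pow_mul (k : ℕ) : (2 * k)! ≤ 4 ^ k * (k ! * k !) := by
  have h_choose : (2 * k).choose k ≤ 4 ^ k := by
    simpa [pow_mul] using Nat.choose_le_two_pow (2 * k) k
  rw [← Nat.choose_mul_factorial_mul_factorial (by lia : k ≤ 2 * k),
    show 2 * k - k = k by lia, mul_assoc]
  exact Nat.mul_le_mul_right _ h_choose

lemma abs_pfaffian_le {u : Fin k × Fin 2 → ℝ} (hu : ∀ p, 0 ≤ u p)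
    (hM : ∀ p q, |M p q| ≤ u p * u q) :
    |pfaffian M| ≤ (2 * √k) ^ k * ∏ i, (u (i, 0) * u (i, 1)) := by
  set P := ∏ i, (u (i, 0) * u (i, 1))
  have hP : 0 ≤ P := Finset.prod_nonneg fun i _ => mul_nonneg (hu _) (hu _)
  have h_det : ∀ σ : Equiv.Perm (Fin k × Fin 2),
      |((Equiv.Perm.sign σ : ℤ) : ℝ) * (Matrix.of fun i j => M (σ (i, 0)) (σ (j, 1))).det| ≤
        P * √k ^ k := fun σ => by
    have h_sign : |((Equiv.Perm.sign σ : ℤ) : ℝ)| = 1 := by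
      rcases Int.units_eq_one_or (Equiv.Perm.sign σ) with h | h <;> simp [h]
    rw [abs_mul, h_sign, one_mul]
    refine (abs_det_le_of_abs_le_mul (fun i => hu (σ (i, 0))) (fun j => hu (σ (j, 1)))
      fun i j => hM _ _).trans_eq ?_
    rw [← Finset.prod_mul_distrib, prod_perm_mul_prod_perm σ u, Fintype.card_fin]
  have h_sum : (k ! : ℝ) * |∑ σ : Equiv.Perm (Fin k × Fin 2),
        ((Equiv.Perm.sign σ : ℤ) : ℝ) * ∏ l : Fin k, M (σ (l, 0)) (σ (l, 1))| ≤
      k ! * (4 ^ k * k ! * (P * √k ^ k)) := by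
    rw [← Nat.abs_cast, ← abs_mul, factorial_mul_sum_perm_eq, Nat.abs_cast]
    calc _ ≤ ∑ _σ : Equiv.Perm (Fin k × Fin 2), P * √k ^ k :=
          (Finset.abs_sum_le_sum_abs _ _).trans (Finset.sum_le_sum fun σ _ => h_det σ)
      _ = ((2 * k)! : ℕ) * (P * √k ^ k) := by simp [Fintype.card_perm, mul_comm]
      _ ≤ (4 ^ k * (k ! * k !) : ℕ) * (P * √k ^ k) := by
          gcongr; exact factorial_two_mul_le_four_pow_mul k
      _ = _ := by push_cast; ring
  rw [pfaffian, abs_mul, abs_of_pos (by positivity : (0 : ℝ) < 1 / (2 ^ k * (k ! : ℝ))),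
    div_mul_eq_mul_div, one_mul, div_le_iff₀ (by positivity)]
  refine (le_of_mul_le_mul_left h_sum (by positivity)).trans_eq ?_
  rw [show (4 : ℝ) = 2 * 2 by norm_num]
  simp only [mul_pow]
  ring

/-- Since `k ^ k ≤ e ^ k k!`, the square of the general term is at most `(e R²) ^ k / k!`. -/
lemma summable_pow_mul_sqrt_pow_div_factorial (R : ℝ) :
    Summable fun k : ℕ => R ^ k * √k ^ k / k ! := by
  have h_sum := (summable_geometric_of_lt_one (by norm_num) one_half_lt_one).add
    (Real.summable_pow_div_factorial (2 * Real.exp 1 * R ^ 2))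
  refine Summable.of_norm_bounded h_sum fun k => ?_
  have hk : (0 : ℝ) < k ! := by positivity
  have h_pow : (k : ℝ) ^ k ≤ Real.exp 1 ^ k * k ! := by
    have h_exp := Real.pow_div_factorial_le_exp (k : ℝ) (by positivity) k
    rw [div_le_iff₀ hk] at h_exp
    rwa [← Real.exp_nat_mul, mul_one]
  have h_sq : (R ^ k * √k ^ k / k !) ^ 2 ≤
      (1 / 2) ^ k * ((2 * Real.exp 1 * R ^ 2) ^ k / k !) := by
    calc (R ^ k * √k ^ k / k !) ^ 2 = (R ^ 2) ^ k * k ^ k / (k ! * k !) := by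
          rw [div_pow, mul_pow, pow_right_comm R, pow_right_comm √k, Real.sq_sqrt (by positivity),
            sq (k ! : ℝ)]
      _ ≤ (R ^ 2) ^ k * (Real.exp 1 ^ k * k !) / (k ! * k !) := by gcongr
      _ = (1 / 2 * (2 * Real.exp 1 * R ^ 2)) ^ k / k ! := by
          rw [← mul_assoc, mul_div_mul_right _ _ hk.ne', ← mul_pow]; ring_nf
      _ = _ := by rw [mul_pow, mul_div_assoc]
  have h_left : (0 : ℝ) ≤ (1 / 2) ^ k := by positivity
  have h_right : 0 ≤ (2 * Real.exp 1 * R ^ 2) ^ k / k ! := by positivity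
  rw [Real.norm_eq_abs]
  exact abs_le_of_sq_le_sq (by nlinarith) (by positivity)

end Bound

/-! ### Absolute convergence for dominated kernels -/

/-- The entries `K_{st}(x, y)` are dominated on `S × S` by `w_s(x) w_t(y)`, with `w_0 w_1`
integrable: this makes all monomials of the Pfaffians integrable. -/
structure DominatedOn (K : Kernel) (S : Set ℝ) (w : Fin 2 → ℝ → ℝ) : Prop where
  measurableSet : MeasurableSet S
  measurable : ∀ s t, Measurable fun p : ℝ × ℝ => K p.1 p.2 s t
  integrableOn : IntegrableOn (fun x => w 0 x * w 1 x) S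
  nonneg : ∀ s x, 0 ≤ w s x
  bound : ∀ x ∈ S, ∀ y ∈ S, ∀ s t, |K x y s t| ≤ w s x * w t y

lemma pfaffian_blockMatrix_eq (K : Kernel) {k : ℕ} (x : Fin k → ℝ) :
    pfaffian (blockMatrix K x) = 1 / (2 ^ k * (k ! : ℝ)) *
      ∑ σ : Equiv.Perm (Fin k × Fin 2), ((Equiv.Perm.sign σ : ℤ) : ℝ) * slotMonomial K σ x :=
  rfl

namespace DominatedOn

variable {κ : Type*} [Fintype κ] {K : Kernel} {S : Set ℝ} {w : Fin 2 → ℝ → ℝ}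

lemma neg (h : DominatedOn K S w) : DominatedOn (-K) S w where
  measurableSet := h.measurableSet
  measurable s t := (h.measurable s t).neg
  integrableOn := h.integrableOn
  nonneg := h.nonneg
  bound x hx y hy s t := by simpa using h.bound x hx y hy s t

lemma integrableOn_prod (h : DominatedOn K S w) :
    IntegrableOn (fun z : κ → ℝ => ∏ q, (w 0 (z q) * w 1 (z q))) (Set.univ.pi fun _ => S) := by
  rw [IntegrableOn, restrict_volume_pi]
  exact Integrable.fintype_prod (f := fun _ x => w 0 x * w 1 x) fun _ => h.integrableOn

lemma abs_slotMonomial_le (h : DominatedOn K S w) (ρ : Equiv.Perm (κ × Fin 2)) {z : κ → ℝ}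
    (hz : z ∈ Set.univ.pi fun _ => S) :
    |slotMonomial K ρ z| ≤ ∏ q, (w 0 (z q) * w 1 (z q)) := by
  rw [slotMonomial, Finset.abs_prod, ← prod_perm_mul_prod_perm ρ fun q => w q.2 (z q.1)]
  exact Finset.prod_le_prod (fun _ _ => abs_nonneg _) fun l _ =>
    h.bound _ (hz _ (Set.mem_univ _)) _ (hz _ (Set.mem_univ _)) _ _

lemma integrableOn_slotMonomial (h : DominatedOn K S w) (ρ : Equiv.Perm (κ × Fin 2)) :
    IntegrableOn (slotMonomial K ρ) (Set.univ.pi fun _ => S) := by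
  have h_measurable : Measurable (slotMonomial K ρ) := by
    refine Finset.measurable_fun_prod _ fun l _ => ?_
    have h_pair : Measurable fun z : κ → ℝ => (z (ρ (l, 0)).1, z (ρ (l, 1)).1) := by fun_prop
    exact (h.measurable (ρ (l, 0)).2 (ρ (l, 1)).2).comp h_pair
  refine h.integrableOn_prod.mono' h_measurable.aestronglyMeasurable ?_
  filter_upwards [ae_restrict_mem (MeasurableSet.univ_pi fun _ => h.measurableSet)] with z hz
  exact h.abs_slotMonomial_le ρ hz

lemma integrableOn_pfaffian (h : DominatedOn K S w) (k : ℕ) :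
    IntegrableOn (fun x : Fin k → ℝ => pfaffian (blockMatrix K x)) (Set.univ.pi fun _ => S) := by
  simp only [pfaffian_blockMatrix_eq]
  exact (integrable_finsetSum _ fun σ _ =>
    (h.integrableOn_slotMonomial σ).const_mul _).const_mul _

lemma abs_fredholmTerm_le (h : DominatedOn K S w) (k : ℕ) :
    |fredholmTerm K S k| ≤ (2 * √k) ^ k * (∫ x in S, w 0 x * w 1 x) ^ k / k ! := by
  have h_integral : ∫ z in Set.univ.pi (fun _ : Fin k => S),
      (2 * √k) ^ k * ∏ q, (w 0 (z q) * w 1 (z q)) =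
        (2 * √k) ^ k * (∫ x in S, w 0 x * w 1 x) ^ k := by
    rw [integral_const_mul, restrict_volume_pi,
      integral_fintype_prod_eq_pow (fun x => w 0 x * w 1 x), Fintype.card_fin]
  rw [fredholmTerm, abs_mul, abs_of_pos (by positivity : (0 : ℝ) < 1 / k !), one_div_mul_eq_div,
    ← h_integral]
  gcongr
  rw [← Real.norm_eq_abs]
  refine norm_integral_le_of_norm_le ((h.integrableOn_prod (κ := Fin k)).const_mul _) ?_
  filter_upwards [ae_restrict_mem (MeasurableSet.univ_pi fun _ => h.measurableSet)] with z hz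
  exact abs_pfaffian_le (u := fun p => w p.2 (z p.1)) (fun p => h.nonneg _ _) fun p q =>
    h.bound _ (hz _ (Set.mem_univ _)) _ (hz _ (Set.mem_univ _)) _ _

lemma summable_pow_mul_abs_fredholmTerm (h : DominatedOn K S w) {t : ℝ} (ht : 0 ≤ t) :
    Summable fun k : ℕ => t ^ k * |fredholmTerm K S k| := by
  refine Summable.of_nonneg_of_le (fun k => by positivity) (fun k => ?_)
    (summable_pow_mul_sqrt_pow_div_factorial (t * 2 * ∫ x in S, w 0 x * w 1 x))
  calc _ ≤ t ^ k * ((2 * √k) ^ k * (∫ x in S, w 0 x * w 1 x) ^ k / k !) := by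
        gcongr; exact h.abs_fredholmTerm_le k
    _ = _ := by simp only [mul_pow]; ring

lemma fredholmConverges (h : DominatedOn K S w) : FredholmConverges K S :=
  ⟨h.integrableOn_pfaffian, Summable.of_abs (by
    simpa only [one_pow, one_mul] using h.summable_pow_mul_abs_fredholmTerm zero_le_one)⟩

end DominatedOn

/-! ### The terms of the expansion of `Pf (J + B)` -/

/-- `∑_ρ sign(ρ) ∫ ∏_l K(ρ(l, 0), ρ(l, 1))`: the integral of a Pfaffian, without its normalisation
and with an arbitrary set of labels for the variables. -/
def signedSum (κ : Type*) [Fintype κ] [DecidableEq κ] (K : Kernel) (S : Set ℝ) : ℝ :=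
  ∑ ρ : Equiv.Perm (κ × Fin 2), ((Equiv.Perm.sign ρ : ℤ) : ℝ) *
    ∫ z in Set.univ.pi (fun _ : κ => S), slotMonomial K ρ z

lemma signedSum_congr {κ ι : Type*} [Fintype κ] [DecidableEq κ] [Fintype ι] [DecidableEq ι]
    (e : κ ≃ ι) (K : Kernel) (S : Set ℝ) : signedSum κ K S = signedSum ι K S := by
  refine Fintype.sum_equiv (Equiv.permCongr (e.prodCongr (Equiv.refl (Fin 2)))) _ _ fun ρ => ?_
  rw [Equiv.Perm.sign_permCongr, ← setIntegral_pi_comp_equiv e S]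
  congr 1
  refine integral_congr_ae (ae_of_all _ fun y => ?_)
  simp only [slotMonomial]
  rw [← Equiv.prod_comp e]
  simp [slotEntry, Equiv.permCongr_apply]

lemma DominatedOn.signedSum_fin {K : Kernel} {S : Set ℝ} {w : Fin 2 → ℝ → ℝ}
    (h : DominatedOn K S w) (n : ℕ) :
    signedSum (Fin n) K S = 2 ^ n * n ! * n ! * fredholmTerm K S n := by
  have hn : (n ! : ℝ) ≠ 0 := by positivity
  simp only [fredholmTerm, pfaffian_blockMatrix_eq]
  rw [integral_const_mul, integral_finsetSum _ fun σ _ =>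
    (h.integrableOn_slotMonomial σ).const_mul _]
  simp only [integral_const_mul]
  rw [signedSum]
  field_simp

/-- The kernel `[[K₁₁, 2 K₁₂], [2 K₂₁, 4 K₂₂ + c δ']]`. -/
def doubledWithDelta (K : Kernel) (c : ℝ) : DeltaKernel where
  regular x y := Matrix.of fun s t => 2 ^ (s : ℕ) * 2 ^ (t : ℕ) * K x y s t
  coeff := c

section Terms

variable {α β : Type*} {k : ℕ}

lemma keep_injective : Function.Injective (keep (α := α) (β := β)) :=
  Function.LeftInverse.injective collapse_keep

/-- The positions of the `δ'` factors. -/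
def deltaPositions [Fintype β] (π : (α ⊕ β × Fin 2) ≃ Fin k) : Finset (Fin k) :=
  Finset.univ.map ⟨fun b => π (Sum.inr (b, 1)), fun b b' h => by simpa using h⟩

lemma mem_deltaPositions [Fintype β] {π : (α ⊕ β × Fin 2) ≃ Fin k} {l : Fin k} :
    l ∈ deltaPositions π ↔ ∃ b, π (Sum.inr (b, 1)) = l := by
  simp only [deltaPositions, Finset.mem_map, Finset.mem_univ, true_and]
  rfl

lemma compl_deltaPositions [Fintype α] [Fintype β] (π : (α ⊕ β × Fin 2) ≃ Fin k) :
    (deltaPositions π)ᶜ =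
      Finset.univ.map ⟨fun q => π (keep q), π.injective.comp keep_injective⟩ := by
  ext l
  obtain ⟨t, rfl⟩ := π.surjective l
  rcases t with a | ⟨b, s⟩
  · simp [mem_deltaPositions, keep]
  · fin_cases s <;> simp [mem_deltaPositions, keep]

lemma regularProd_assemble [Fintype α] [Fintype β] (K : Kernel) (c : ℝ)
    (π τ : (α ⊕ β × Fin 2) ≃ Fin k) (ρ : Equiv.Perm ((α ⊕ β) × Fin 2)) :
    (doubledWithDelta K c).regularProd (assemble π τ ρ) (deltaPositions π) =
      fun x => 2 ^ Fintype.card α * slotMonomial K (slot τ ∘ ρ) x := by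
  ext1 x
  have h_doubling : ∏ l, ((2 : ℝ) ^ ((slot τ (ρ (l, 0))).2 : ℕ) *
      2 ^ ((slot τ (ρ (l, 1))).2 : ℕ)) = 2 ^ Fintype.card α := by
    rw [prod_perm_mul_prod_perm ρ fun q => (2 : ℝ) ^ ((slot τ q).2 : ℕ), Fintype.prod_sum_type]
    simp [slot]
  rw [DeltaKernel.regularProd, compl_deltaPositions, Finset.prod_map, slotMonomial, ← h_doubling,
    ← Finset.prod_mul_distrib]
  simp only [Function.Embedding.coeFn_mk, assemble_keep]
  rfl

lemma exists_deltaPairs_assemble_eq [Fintype β] (π τ : (α ⊕ β × Fin 2) ≃ Fin k) :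
    ∃ L : List β, L.Nodup ∧ (∀ b, b ∈ L) ∧ ∀ ρ : Equiv.Perm ((α ⊕ β) × Fin 2),
      deltaPairs (assemble π τ ρ) (deltaPositions π) = L.map (deltaPair τ) := by
  let position : β → Fin k := fun b => π (Sum.inr (b, 1))
  have h_injective : Function.Injective position := fun b b' h => by simpa [position] using h
  obtain ⟨L, hL⟩ : (List.finRange k).filter (fun l => l ∈ deltaPositions π) ∈
      Set.range (List.map position) := by
    rw [Set.range_list_map]
    intro l hl
    exact mem_deltaPositions.1 (by simpa using hl)
  refine ⟨L, ?_, fun b => ?_, fun ρ => ?_⟩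
  · refine List.Nodup.of_map position ?_
    rw [hL]
    exact (List.nodup_finRange k).filter _
  · rw [← List.mem_map_of_injective h_injective, hL]
    simp [mem_deltaPositions, position]
  · rw [deltaPairs, ← hL, List.map_map]
    refine List.map_congr_left fun b _ => ?_
    simp [position, assemble_inr_one, deltaPair]

variable [Fintype β] {K : Kernel} {S : Set ℝ} {w : Fin 2 → ℝ → ℝ}

lemma DominatedOn.integrableOn_deltaPrimeIntegrand_assemble [Finite α] (h : DominatedOn K S w)
    (hK : IsDerivKernel K) (c : ℝ) (π τ : (α ⊕ β × Fin 2) ≃ Fin k)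
    (ρ : Equiv.Perm ((α ⊕ β) × Fin 2)) :
    IntegrableOn (deltaPrimeIntegrand (deltaPairs (assemble π τ ρ) (deltaPositions π))
      ((doubledWithDelta K c).regularProd (assemble π τ ρ) (deltaPositions π)))
      (Set.univ.pi fun _ => S) := by
  classical
  have := Fintype.ofFinite α
  obtain ⟨L, hL, hL', hP⟩ := exists_deltaPairs_assemble_eq π τ
  rw [hP, regularProd_assemble, funext (hK.deltaPrimeIntegrand_slotMonomial τ ρ _ hL hL')]
  exact (integrable_finsetSum _ fun U _ => (integrableOn_pi_comp_equiv (keepEquiv τ hL')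
    (h.integrableOn_slotMonomial _)).const_mul _).const_mul _

variable [Fintype α] [DecidableEq β]

lemma DominatedOn.deltaPrimeIntegral_assemble (h : DominatedOn K S w) (hK : IsDerivKernel K)
    (c : ℝ) (π τ : (α ⊕ β × Fin 2) ≃ Fin k) (ρ : Equiv.Perm ((α ⊕ β) × Fin 2)) :
    deltaPrimeIntegral S (deltaPairs (assemble π τ ρ) (deltaPositions π))
        ((doubledWithDelta K c).regularProd (assemble π τ ρ) (deltaPositions π)) =
      2 ^ Fintype.card α * ∑ U : Finset β, (-1) ^ U.card *
        ∫ z in Set.univ.pi (fun _ => S), slotMonomial K (flip α U * ρ) z := by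
  obtain ⟨L, hL, hL', hP⟩ := exists_deltaPairs_assemble_eq π τ
  rw [hP, regularProd_assemble, deltaPrimeIntegral,
    funext (hK.deltaPrimeIntegrand_slotMonomial τ ρ _ hL hL'),
    integral_const_mul, integral_finsetSum _ fun U _ =>
      (integrableOn_pi_comp_equiv (keepEquiv τ hL')
        (h.integrableOn_slotMonomial _)).const_mul _]
  congr 1
  refine Finset.sum_congr rfl fun U _ => ?_
  rw [integral_const_mul, setIntegral_pi_comp_equiv (keepEquiv τ hL') S
    (slotMonomial K (flip α U * ρ))]

variable [DecidableEq α]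

lemma sum_sign_mul_integral_flip (U : Finset β) (K : Kernel) (S : Set ℝ) :
    ∑ ρ : Equiv.Perm ((α ⊕ β) × Fin 2), ((Equiv.Perm.sign ρ : ℤ) : ℝ) *
        ∫ z in Set.univ.pi (fun _ => S), slotMonomial K (flip α U * ρ) z =
      (-1) ^ (Fintype.card β + U.card) * signedSum (α ⊕ β) K S := by
  rw [signedSum, ← Equiv.sum_comp (Equiv.mulLeft (flip α U)) fun ρ =>
    ((Equiv.Perm.sign ρ : ℤ) : ℝ) * ∫ z in Set.univ.pi (fun _ : α ⊕ β => S), slotMonomial K ρ z,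
    Finset.mul_sum]
  refine Finset.sum_congr rfl fun ρ _ => ?_
  simp only [Equiv.coe_mulLeft, Equiv.Perm.sign_mul, sign_flip]
  push_cast
  rw [← mul_assoc, ← mul_assoc, ← mul_pow]
  norm_num

/-- The signs of `assemble` and `flip` cancel against those of the derivatives, so that each of the
`2 ^ card β` choices of derivatives contributes the same amount. -/
lemma DominatedOn.sum_sign_assemble_mul_deltaPrimeIntegral (h : DominatedOn K S w)
    (hK : IsDerivKernel K) (c : ℝ) (π τ : (α ⊕ β × Fin 2) ≃ Fin k) :
    ∑ ρ : Equiv.Perm ((α ⊕ β) × Fin 2), ((Equiv.Perm.sign (assemble π τ ρ) : ℤ) : ℝ) *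
        deltaPrimeIntegral S (deltaPairs (assemble π τ ρ) (deltaPositions π))
          ((doubledWithDelta K c).regularProd (assemble π τ ρ) (deltaPositions π)) =
      2 ^ (Fintype.card α + Fintype.card β) * signedSum (α ⊕ β) K S := by
  let I (U : Finset β) (ρ : Equiv.Perm ((α ⊕ β) × Fin 2)) : ℝ :=
    ((Equiv.Perm.sign ρ : ℤ) : ℝ) *
      ∫ z in Set.univ.pi (fun _ => S), slotMonomial K (flip α U * ρ) z
  calc _ = ∑ ρ, 2 ^ Fintype.card α * ∑ U : Finset β, (-1) ^ (Fintype.card β + U.card) * I U ρ := by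
        refine Finset.sum_congr rfl fun ρ _ => ?_
        rw [h.deltaPrimeIntegral_assemble hK, sign_assemble]
        simp only [I, Finset.mul_sum, pow_add]
        refine Finset.sum_congr rfl fun U _ => ?_
        push_cast
        ring
    _ = 2 ^ Fintype.card α * ∑ U : Finset β, (-1) ^ (Fintype.card β + U.card) * ∑ ρ, I U ρ := by
        rw [← Finset.mul_sum, Finset.sum_comm]
        simp only [Finset.mul_sum]
    _ = 2 ^ Fintype.card α * ∑ _U : Finset β, signedSum (α ⊕ β) K S := by
        simp only [I, sum_sign_mul_integral_flip]
        simp only [← mul_assoc, ← mul_pow]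
        norm_num
    _ = _ := by simp [pow_add, mul_assoc]

end Terms

section Count

lemma exists_equiv_extending {B T V : Type*} [Fintype T] [Fintype V]
    (h : Fintype.card T = Fintype.card V) {f : B → T} (hf : Function.Injective f) {g : B → V}
    (hg : Function.Injective g) : ∃ e : T ≃ V, ∀ b, e (f b) = g b := by
  classical
  have h_extend : ∀ b, Function.extend f g (Fintype.equivOfCardEq h) (f b) = g b :=
    fun b => hf.extend_apply g _ b
  obtain ⟨e, he⟩ := Set.MapsTo.exists_equiv_extend_of_card_eq (t := (Finset.univ : Finset V)) h
    (s := Set.range f) (f := Function.extend f g (Fintype.equivOfCardEq h))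
    (fun _ _ => by simp) (by
      rintro _ ⟨b, rfl⟩ _ ⟨b', rfl⟩ hbb'
      rw [h_extend, h_extend] at hbb'
      rw [hg hbb'])
  exact ⟨e.trans (Equiv.subtypeUnivEquiv Finset.mem_univ), fun b =>
    (he _ ⟨b, rfl⟩).trans (h_extend b)⟩

variable {k : ℕ} {D : Finset (Fin k)}

/-- The variables of the `δ'` factors. -/
def deltaVars (D : Finset (Fin k)) (σ : Equiv.Perm (Fin k × Fin 2)) (q : D × Fin 2) : Fin k :=
  (σ (q.1, q.2)).1

lemma apply_eq_of_admissible {σ : Equiv.Perm (Fin k × Fin 2)} (hσ : Admissible σ D) (l : D)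
    (s : Fin 2) : σ (l, s) = (deltaVars D σ (l, s), 1) := by
  refine Prod.ext rfl ?_
  fin_cases s
  exacts [(hσ l l.2).1, (hσ l l.2).2]

lemma deltaVars_injective {σ : Equiv.Perm (Fin k × Fin 2)} (hσ : Admissible σ D) :
    Function.Injective (deltaVars D σ) := by
  rintro ⟨l, s⟩ ⟨l', s'⟩ h
  have h_apply : σ (l, s) = σ (l', s') := by
    rw [apply_eq_of_admissible hσ, apply_eq_of_admissible hσ, h]
  obtain ⟨h_val, h_slot⟩ := Prod.mk.inj (σ.injective h_apply)
  exact Prod.ext (Subtype.ext h_val) h_slot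

lemma two_mul_card_le_of_injective {e : D × Fin 2 → Fin k} (he : Function.Injective e) :
    2 * D.card ≤ k := by
  have := Fintype.card_le_of_injective e he
  simp only [Fintype.card_prod, Fintype.card_coe, Fintype.card_fin] at this
  lia

lemma exists_labels {e : D × Fin 2 → Fin k} (he : Function.Injective e) :
    ∃ π τ : (Fin (k - 2 * D.card) ⊕ D × Fin 2) ≃ Fin k,
      deltaPositions π = D ∧ ∀ σ : Equiv.Perm (Fin k × Fin 2),
        Admissible σ D ∧ deltaVars D σ = e ↔ ∃ ρ, assemble π τ ρ = σ := by
  have h_card : Fintype.card (Fin (k - 2 * D.card) ⊕ D × Fin 2) = Fintype.card (Fin k) := by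
    have := two_mul_card_le_of_injective he
    simp only [Fintype.card_sum, Fintype.card_prod, Fintype.card_coe, Fintype.card_fin]
    lia
  obtain ⟨π, hπ⟩ := exists_equiv_extending h_card
    (f := fun l : D => Sum.inr (l, 1)) (fun l l' h => by simpa using h) Subtype.val_injective
  obtain ⟨τ, hτ⟩ := exists_equiv_extending h_card Sum.inr_injective he
  refine ⟨π, τ, by ext l; simp [mem_deltaPositions, hπ], fun σ => ⟨?_, ?_⟩⟩
  · rintro ⟨hσ, rfl⟩
    refine exists_assemble_eq π τ σ fun l s => ?_
    rw [hπ, hτ, apply_eq_of_admissible hσ]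
  · rintro ⟨ρ, rfl⟩
    have h_apply : ∀ (l : D) (s : Fin 2), assemble π τ ρ (l, s) = (e (l, s), 1) := fun l s => by
      rw [← hπ, assemble_inr_one, hτ]
    refine ⟨fun l hl => ?_, funext fun ⟨l, s⟩ => ?_⟩
    · exact ⟨congrArg Prod.snd (h_apply ⟨l, hl⟩ 0), congrArg Prod.snd (h_apply ⟨l, hl⟩ 1)⟩
    · exact congrArg Prod.fst (h_apply l s)

lemma card_filter_injective (D : Finset (Fin k)) [DecidablePred fun e : D × Fin 2 → Fin k =>
    Function.Injective e] :
    (Finset.univ.filter fun e : D × Fin 2 → Fin k => Function.Injective e).card =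
      k.descFactorial (2 * D.card) := by
  rw [← Fintype.card_subtype, Fintype.card_congr (Equiv.subtypeInjectiveEquivEmbedding _ _),
    Fintype.card_embedding_eq]
  simp [mul_comm]

variable {K : Kernel} {S : Set ℝ} {w : Fin 2 → ℝ → ℝ}

lemma DominatedOn.integrableOn_deltaPrimeIntegrand (h : DominatedOn K S w)
    (hK : IsDerivKernel K) (c : ℝ) {σ : Equiv.Perm (Fin k × Fin 2)} (hσ : Admissible σ D) :
    IntegrableOn
      (deltaPrimeIntegrand (deltaPairs σ D) ((doubledWithDelta K c).regularProd σ D))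
      (Set.univ.pi fun _ => S) := by
  obtain ⟨π, τ, hD, hτ⟩ := exists_labels (deltaVars_injective hσ)
  obtain ⟨ρ, rfl⟩ := (hτ σ).1 ⟨hσ, rfl⟩
  have h_integrable := h.integrableOn_deltaPrimeIntegrand_assemble hK c π τ ρ
  rwa [hD] at h_integrable

lemma DominatedOn.sum_sign_mul_deltaPrimeIntegral_of_deltaVars_eq (h : DominatedOn K S w)
    (hK : IsDerivKernel K) (c : ℝ) {e : D × Fin 2 → Fin k} (he : Function.Injective e) :
    ∑ σ : Equiv.Perm (Fin k × Fin 2) with Admissible σ D ∧ deltaVars D σ = e,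
        ((Equiv.Perm.sign σ : ℤ) : ℝ) * deltaPrimeIntegral S (deltaPairs σ D)
          ((doubledWithDelta K c).regularProd σ D) =
      2 ^ (k - D.card) * signedSum (Fin (k - D.card)) K S := by
  obtain ⟨π, τ, hD, hτ⟩ := exists_labels he
  have h_filter : (Finset.univ.filter fun σ : Equiv.Perm (Fin k × Fin 2) =>
      Admissible σ D ∧ deltaVars D σ = e) =
        Finset.univ.map ⟨assemble π τ, assemble_injective π τ⟩ := by
    ext σ
    simp only [Finset.mem_filter, Finset.mem_univ, true_and, hτ, Finset.mem_map,
      Function.Embedding.coeFn_mk]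
  have h_card : Fintype.card (Fin (k - 2 * D.card)) + Fintype.card D = k - D.card := by
    have := two_mul_card_le_of_injective he
    simp only [Fintype.card_coe, Fintype.card_fin]
    lia
  have h_sum := h.sum_sign_assemble_mul_deltaPrimeIntegral hK c π τ
  rw [hD, h_card, signedSum_congr (Fintype.equivFinOfCardEq (Fintype.card_sum.trans h_card))]
    at h_sum
  rw [h_filter, Finset.sum_map]
  exact h_sum

lemma DominatedOn.sum_admissible_sign_mul_deltaPrimeIntegral (h : DominatedOn K S w)
    (hK : IsDerivKernel K) (c : ℝ) (D : Finset (Fin k)) :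
    ∑ σ : Equiv.Perm (Fin k × Fin 2) with Admissible σ D, ((Equiv.Perm.sign σ : ℤ) : ℝ) *
        deltaPrimeIntegral S (deltaPairs σ D) ((doubledWithDelta K c).regularProd σ D) =
      k.descFactorial (2 * D.card) * (2 ^ (k - D.card) * signedSum (Fin (k - D.card)) K S) := by
  classical
  rw [← Finset.sum_fiberwise_of_maps_to (g := deltaVars D)
      (t := Finset.univ.filter Function.Injective)
      (fun σ hσ => by simpa using deltaVars_injective (Finset.mem_filter.1 hσ).2),
    ← card_filter_injective D, ← nsmul_eq_mul]
  refine Finset.sum_eq_card_nsmul fun e he => ?_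
  rw [Finset.filter_filter]
  exact h.sum_sign_mul_deltaPrimeIntegral_of_deltaVars_eq hK c (Finset.mem_filter.1 he).2

lemma DominatedOn.pfaffianIntegral_doubledWithDelta (h : DominatedOn K S w)
    (hK : IsDerivKernel K) (c : ℝ) (k : ℕ) :
    (doubledWithDelta K c).pfaffianIntegral S k =
      1 / (2 ^ k * (k ! : ℝ)) * ∑ m ∈ Finset.range (k + 1), (k.choose m : ℝ) *
        (c ^ m * (k.descFactorial (2 * m) * (2 ^ (k - m) * signedSum (Fin (k - m)) K S))) := by
  have h_card := Finset.sum_powerset_apply_card (fun m => c ^ m * (k.descFactorial (2 * m) *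
    (2 ^ (k - m) * signedSum (Fin (k - m)) K S))) (x := (Finset.univ : Finset (Fin k)))
  simp only [Finset.card_univ, Fintype.card_fin, nsmul_eq_mul, Finset.powerset_univ] at h_card
  rw [DeltaKernel.pfaffianIntegral, ← h_card]
  congr 1
  simp only [Finset.mul_sum, Finset.sum_filter]
  rw [Finset.sum_comm]
  refine Finset.sum_congr rfl fun D _ => ?_
  rw [← h.sum_admissible_sign_mul_deltaPrimeIntegral hK c D, Finset.mul_sum, Finset.sum_filter]
  refine Finset.sum_congr rfl fun σ _ => ?_
  rw [mul_left_comm, mul_ite_zero]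
  rfl

lemma choose_mul_descFactorial_mul_factorial_mul_factorial (n m : ℕ) :
    (n + m).choose m * (n + m).descFactorial (2 * m) * (n ! * n !) =
      (n + m)! * (n + m)! * n.choose m := by
  rcases le_or_gt m n with hmn | hnm
  · have h_choose := Nat.choose_mul_factorial_mul_factorial (Nat.le_add_left m n)
    have h_desc := Nat.factorial_mul_descFactorial (by lia : 2 * m ≤ n + m)
    rw [Nat.add_sub_cancel] at h_choose
    rw [show n + m - 2 * m = n - m by lia] at h_desc
    rw [← Nat.choose_mul_factorial_mul_factorial hmn]
    calc _ = (n + m).choose m * m ! *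
            (n.choose m * m ! * (n - m)!) * ((n - m)! * (n + m).descFactorial (2 * m)) *
              n.choose m := by ring
      _ = _ := by
        rw [Nat.choose_mul_factorial_mul_factorial hmn, h_choose, h_desc]
  · rw [Nat.descFactorial_of_lt (by lia), Nat.choose_eq_zero_of_lt hnm]
    simp

lemma DominatedOn.fredholmTerm_doubledWithDelta (h : DominatedOn K S w) (hK : IsDerivKernel K)
    (c : ℝ) (k : ℕ) :
    (doubledWithDelta K c).fredholmTerm S k = ∑ q ∈ Finset.HasAntidiagonal.antidiagonal k,
      c ^ q.2 * (2 ^ (q.1 - q.2) * q.1.choose q.2) * fredholmTerm K S q.1 := by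
  rw [DeltaKernel.fredholmTerm, h.pfaffianIntegral_doubledWithDelta hK, ← mul_assoc,
    Finset.mul_sum, ← Finset.Nat.sum_antidiagonal_swap,
    Finset.Nat.sum_antidiagonal_eq_sum_range_succ_mk]
  refine Finset.sum_congr rfl fun m hm => ?_
  obtain ⟨n, rfl⟩ := Nat.exists_eq_add_of_le' (Finset.mem_range_succ_iff.1 hm)
  simp only [Prod.swap]
  have h_factorial : ((n + m).choose m * (n + m).descFactorial (2 * m) * (n ! * n !) : ℝ) =
      (n + m)! * (n + m)! * n.choose m :=
    mod_cast choose_mul_descFactorial_mul_factorial_mul_factorial n m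
  have h_pow : (2 : ℝ) ^ n * 2 ^ n * n.choose m = 2 ^ (n + m) * (2 ^ (n - m) * n.choose m) := by
    rcases le_or_gt m n with hmn | hnm
    · rw [← mul_assoc, ← pow_add, ← pow_add]
      congr 2
      lia
    · simp [Nat.choose_eq_zero_of_lt hnm]
  rw [Nat.add_sub_cancel, h.signedSum_fin]
  calc _ = c ^ m * fredholmTerm K S n * (2 ^ n * 2 ^ n) *
          ((n + m).choose m * (n + m).descFactorial (2 * m) * (n ! * n !)) /
            (2 ^ (n + m) * ((n + m)! * (n + m)!)) := by ring
    _ = c ^ m * fredholmTerm K S n * ((n + m)! * (n + m)!) *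
          (2 ^ n * 2 ^ n * n.choose m) / (2 ^ (n + m) * ((n + m)! * (n + m)!)) := by
        rw [h_factorial]; ring
    _ = _ := by rw [h_pow]; field_simp

end Count

/-! ### Summation of the expansion -/

section Summation

variable {K : Kernel} {S : Set ℝ} {w : Fin 2 → ℝ → ℝ}

lemma hasSum_mul_choose (x y c : ℝ) (n : ℕ) :
    HasSum (fun m : ℕ => x ^ m * (y ^ (n - m) * n.choose m) * c) ((x + y) ^ n * c) := by
  refine HasSum.mul_right c ?_
  rw [add_pow]
  simp only [mul_assoc]
  refine hasSum_sum_of_ne_finset_zero fun m hm => ?_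
  rw [Nat.choose_eq_zero_of_lt (by simpa using hm)]
  simp

lemma DominatedOn.summable_mul_choose (h : DominatedOn K S w) (c : ℝ) :
    Summable fun q : ℕ × ℕ =>
      c ^ q.2 * (2 ^ (q.1 - q.2) * q.1.choose q.2) * fredholmTerm K S q.1 := by
  have h_abs : ∀ q : ℕ × ℕ,
      |c ^ q.2 * (2 ^ (q.1 - q.2) * q.1.choose q.2) * fredholmTerm K S q.1| =
        |c| ^ q.2 * (2 ^ (q.1 - q.2) * q.1.choose q.2) * |fredholmTerm K S q.1| := by
    intro q
    rw [abs_mul, abs_mul, abs_pow, abs_of_nonneg (by positivity :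
      (0 : ℝ) ≤ 2 ^ (q.1 - q.2) * q.1.choose q.2)]
  have h_fiber := fun n => hasSum_mul_choose |c| 2 |fredholmTerm K S n| n
  refine Summable.of_abs ?_
  simp only [h_abs]
  refine (summable_prod_of_nonneg fun q => by simp only [Pi.zero_apply]; positivity).2
    ⟨fun n => (h_fiber n).summable, ?_⟩
  simp only [fun n => (h_fiber n).tsum_eq]
  exact h.summable_pow_mul_abs_fredholmTerm (by positivity)

lemma DominatedOn.hasSum_fredholmTerm_doubledWithDelta (h : DominatedOn K S w)
    (hK : IsDerivKernel K) (c : ℝ) :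
    HasSum (fun k => (doubledWithDelta K c).fredholmTerm S k)
      (∑' n, (c + 2) ^ n * fredholmTerm K S n) := by
  have h_summable := h.summable_mul_choose c
  have h_hasSum := (Finset.HasAntidiagonal.sigmaAntidiagonalEquivProd.hasSum_iff).2
    h_summable.hasSum
  rw [h_summable.tsum_prod] at h_hasSum
  simp only [fun n => (hasSum_mul_choose c 2 (fredholmTerm K S n) n).tsum_eq] at h_hasSum
  refine h_hasSum.sigma fun k => ?_
  rw [h.fredholmTerm_doubledWithDelta hK, ← Finset.sum_finset_coe]
  exact hasSum_fintype _

lemma DominatedOn.fredholmConverges_doubledWithDelta (h : DominatedOn K S w)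
    (hK : IsDerivKernel K) (c : ℝ) : (doubledWithDelta K c).FredholmConverges S :=
  ⟨fun _ _ _ hσ => h.integrableOn_deltaPrimeIntegrand hK c hσ,
    (h.hasSum_fredholmTerm_doubledWithDelta hK c).summable⟩

lemma DominatedOn.fredholmPfaffian_doubledWithDelta_neg_one (h : DominatedOn K S w)
    (hK : IsDerivKernel K) :
    (doubledWithDelta K (-1)).fredholmPfaffian S = fredholmPfaffian K S := by
  rw [DeltaKernel.fredholmPfaffian, (h.hasSum_fredholmTerm_doubledWithDelta hK (-1)).tsum_eq,
    fredholmPfaffian]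
  norm_num

end Summation

/-! ### The kernels `𝐀` and `𝐁` -/

section Kernels

variable {A : ℝ → ℝ → ℝ}

lemma hasDerivAt_partialX (hA : Differentiable ℝ fun p : ℝ × ℝ => A p.1 p.2) (x y : ℝ) :
    HasDerivAt (fun u => A u y) (partialX A x y) x := by
  have h_slice : Differentiable ℝ fun u => A u y :=
    hA.comp (differentiable_id.prodMk (differentiable_const y))
  exact (h_slice x).hasDerivAt

lemma hasDerivAt_partialY (hA : Differentiable ℝ fun p : ℝ × ℝ => A p.1 p.2) (x y : ℝ) :
    HasDerivAt (fun u => A x u) (partialY A x y) y := by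
  have h_slice : Differentiable ℝ fun u => A x u :=
    hA.comp ((differentiable_const x).prodMk differentiable_id)
  exact (h_slice y).hasDerivAt

lemma partialX_eq_fderiv (hA : Differentiable ℝ fun p : ℝ × ℝ => A p.1 p.2) (p : ℝ × ℝ) :
    partialX A p.1 p.2 = fderiv ℝ (fun p : ℝ × ℝ => A p.1 p.2) p (1, 0) := by
  refine (hasDerivAt_partialX hA p.1 p.2).unique ?_
  exact (hA p).hasFDerivAt.comp_hasDerivAt p.1
    ((hasDerivAt_id p.1).prodMk (hasDerivAt_const p.1 p.2))

lemma partialY_eq_fderiv (hA : Differentiable ℝ fun p : ℝ × ℝ => A p.1 p.2) (p : ℝ × ℝ) :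
    partialY A p.1 p.2 = fderiv ℝ (fun p : ℝ × ℝ => A p.1 p.2) p (0, 1) := by
  refine (hasDerivAt_partialY hA p.1 p.2).unique ?_
  exact (hA p).hasFDerivAt.comp_hasDerivAt p.2
    ((hasDerivAt_const p.2 p.1).prodMk (hasDerivAt_id p.2))

lemma contDiff_partialX {n : WithTop ℕ∞} (hA : ContDiff ℝ (n + 1) fun p : ℝ × ℝ => A p.1 p.2) :
    ContDiff ℝ n fun p : ℝ × ℝ => partialX A p.1 p.2 := by
  simp only [partialX_eq_fderiv (hA.differentiable (by simp))]
  exact (hA.fderiv_right le_rfl).clm_apply contDiff_const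

lemma contDiff_partialY {n : WithTop ℕ∞} (hA : ContDiff ℝ (n + 1) fun p : ℝ × ℝ => A p.1 p.2) :
    ContDiff ℝ n fun p : ℝ × ℝ => partialY A p.1 p.2 := by
  simp only [partialY_eq_fderiv (hA.differentiable (by simp))]
  exact (hA.fderiv_right le_rfl).clm_apply contDiff_const

lemma partialY_partialX (hA : ContDiff ℝ 2 fun p : ℝ × ℝ => A p.1 p.2) (x y : ℝ) :
    partialY (partialX A) x y = partialX (partialY A) x y := by
  have h_differentiable := hA.differentiable (by simp)
  have h_fderiv : DifferentiableAt ℝ (fderiv ℝ fun p : ℝ × ℝ => A p.1 p.2) (x, y) :=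
    (hA.fderiv_right (m := 1) (by norm_num)).differentiable (by simp) _
  have h_apply : ∀ v : ℝ × ℝ, HasFDerivAt (fun p => fderiv ℝ (fun p : ℝ × ℝ => A p.1 p.2) p v)
      ((fderiv ℝ (fderiv ℝ fun p : ℝ × ℝ => A p.1 p.2) (x, y)).flip v) (x, y) := fun v => by
    simpa using h_fderiv.hasFDerivAt.clm_apply (hasFDerivAt_const v (x, y))
  have h_symm : IsSymmSndFDerivAt ℝ (fun p : ℝ × ℝ => A p.1 p.2) (x, y) :=
    hA.contDiffAt.isSymmSndFDerivAt (by simp)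
  have hX := (contDiff_partialX (n := 1) (by norm_num; exact hA)).differentiable (by simp)
  have hY := (contDiff_partialY (n := 1) (by norm_num; exact hA)).differentiable (by simp)
  rw [partialY_eq_fderiv hX (x, y), partialX_eq_fderiv hY (x, y)]
  simp only [partialX_eq_fderiv h_differentiable, partialY_eq_fderiv h_differentiable]
  rw [(h_apply _).fderiv, (h_apply _).fderiv]
  exact h_symm.eq _ _

lemma isDerivKernel_kernelA (hA : ContDiff ℝ 3 fun p : ℝ × ℝ => A p.1 p.2) :
    IsDerivKernel (kernelA A) := by
  have h_differentiable := hA.differentiable (by simp)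
  have hX := contDiff_partialX (n := 2) (by norm_num; exact hA)
  have hY := contDiff_partialY (n := 2) (by norm_num; exact hA)
  have hX_differentiable := hX.differentiable (by simp)
  have hY_differentiable := hY.differentiable (by simp)
  have hXY := (contDiff_partialX (n := 1) (by norm_num; exact hY)).differentiable (by simp)
  refine ⟨fun s t => ?_, fun x y t => ?_, fun x y s => ?_⟩
  · fin_cases s <;> fin_cases t
    exacts [h_differentiable, hY_differentiable.fun_neg, hX_differentiable.fun_neg, hXY]
  · fin_cases t
    · simpa [kernelA] using hasDerivAt_partialX h_differentiable x y
    · simpa [kernelA] using (hasDerivAt_partialX hY_differentiable x y).fun_neg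
  · fin_cases s
    · simpa [kernelA] using hasDerivAt_partialY h_differentiable x y
    · simpa [kernelA, partialY_partialX (hA.of_le (by norm_num))] using
        (hasDerivAt_partialY hX_differentiable x y).fun_neg

lemma partialX_eq_neg_partialY (hA : ∀ x y, A x y = -A y x) (x y : ℝ) :
    partialX A x y = -partialY A y x := by
  rw [partialX, partialY, ← deriv.fun_neg]
  exact congrArg (fun f => deriv f x) (funext fun s => hA s y)

lemma integrableOn_exp_mul_of_bddBelow {S : Set ℝ} (hS : BddBelow S) {a : ℝ} (ha : a < 0) :
    IntegrableOn (fun x => Real.exp (a * x)) S := by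
  obtain ⟨x₀, hx₀⟩ := hS
  exact (integrableOn_exp_mul_Ioi ha (x₀ - 1)).mono_set fun x hx =>
    (sub_one_lt x₀).trans_le (hx₀ hx)

lemma exists_dominatedOn_kernelA {S : Set ℝ} (hS : MeasurableSet S) (hS' : BddBelow S)
    (hK : IsDerivKernel (kernelA A)) (hA : ∀ x y, A x y = -A y x)
    (h : ExpDecayOn (kernelA A) S) : ∃ w, DominatedOn (kernelA A) S w := by
  obtain ⟨C, a, b, hC, -, hab, h⟩ := h
  have h_sqrt : ∀ u v : ℝ, √C * Real.exp u * (√C * Real.exp v) = C * Real.exp (u + v) :=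
    fun u v => by rw [mul_mul_mul_comm, Real.mul_self_sqrt hC.le, Real.exp_add]
  refine ⟨![fun x => √C * Real.exp (-a * x), fun x => √C * Real.exp (b * x)], hS,
    fun s t => (hK.differentiable s t).continuous.measurable, ?_, fun s x => ?_,
    fun x hx y hy s t => ?_⟩
  · simp only [Matrix.cons_val_zero, Matrix.cons_val_one, h_sqrt, ← add_mul]
    exact (integrableOn_exp_mul_of_bddBelow hS' (by linarith)).const_mul C
  · fin_cases s <;> exact mul_nonneg (Real.sqrt_nonneg C) (Real.exp_nonneg _)
  · obtain ⟨h11, h12, h22⟩ := h x hx y hy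
    have h21 := (h y hy x hx).2.1
    fin_cases s <;> fin_cases t
    · simpa [h_sqrt, sub_eq_add_neg] using h11.le
    · simpa [h_sqrt] using h12.le
    · simpa [h_sqrt, kernelA, partialX_eq_neg_partialY hA, add_comm] using h21.le
    · simpa [h_sqrt] using h22.le

lemma neg_kernelB_eq_doubledWithDelta (A : ℝ → ℝ → ℝ) :
    -kernelB A = doubledWithDelta (-kernelA A) (-1) := by
  refine congrArg (DeltaKernel.mk · (-1)) ?_
  ext x y s t
  fin_cases s <;> fin_cases t <;> norm_num [kernelA, kernelB]

lemma fredholmPfaffian_kernelA_eq_kernelB {S : Set ℝ} (hS : MeasurableSet S) (hS' : BddBelow S)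
    (hA : ContDiff ℝ 3 fun p : ℝ × ℝ => A p.1 p.2) (hA' : ∀ x y, A x y = -A y x)
    (h : ExpDecayOn (kernelA A) S) :
    FredholmConverges (-kernelA A) S ∧ (-kernelB A).FredholmConverges S ∧
      fredholmPfaffian (-kernelA A) S = (-kernelB A).fredholmPfaffian S := by
  have hK := isDerivKernel_kernelA hA
  obtain ⟨w, hw⟩ := exists_dominatedOn_kernelA hS hS' hK hA' h
  rw [neg_kernelB_eq_doubledWithDelta]
  exact ⟨hw.neg.fredholmConverges, hw.neg.fredholmConverges_doubledWithDelta hK.neg (-1),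
    (hw.neg.fredholmPfaffian_doubledWithDelta_neg_one hK.neg).symm⟩

end Kernels

/-! ### Laplace integrals -/

section Laplace

universe u

variable {Ω : Type*} [MeasurableSpace Ω] {μ : Measure Ω}

/-- `p ↦ ∫ exp (L a p) • f a ∂μ(a)`: a Laplace integral with an arbitrary family of linear
exponents. -/
def laplaceIntegral {E F : Type*} [NormedAddCommGroup E] [NormedSpace ℝ E] [NormedAddCommGroup F]
    [NormedSpace ℝ F] [NormedSpace ℂ F] (μ : Measure Ω) (L : Ω → E →L[ℝ] ℂ) (f : Ω → F) (p : E) :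
    F :=
  ∫ a, Complex.exp (L a p) • f a ∂μ

/-- `f` stays integrable when multiplied by any exponential of the size of the exponents `L`. -/
structure RapidlyDecaying {E F : Type*} [NormedAddCommGroup E] [NormedSpace ℝ E]
    [NormedAddCommGroup F] (μ : Measure Ω) (L : Ω → E →L[ℝ] ℂ) (f : Ω → F) : Prop where
  aestronglyMeasurable : AEStronglyMeasurable f μ
  integrable_exp_mul_norm : ∀ R : ℝ, Integrable (fun a => Real.exp (R * ‖L a‖) * ‖f a‖) μ

section

variable {E F G : Type*} [NormedAddCommGroup E] [NormedSpace ℝ E] [NormedAddCommGroup F]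
  [NormedAddCommGroup G] {L : Ω → E →L[ℝ] ℂ} {f : Ω → F} {g : Ω → G}

lemma RapidlyDecaying.of_norm_le (hf : RapidlyDecaying μ L f) (hL : AEStronglyMeasurable L μ)
    (hg : AEStronglyMeasurable g μ) {c : ℝ} (h : ∀ a, ‖g a‖ ≤ Real.exp (c * ‖L a‖) * ‖f a‖) :
    RapidlyDecaying μ L g := by
  refine ⟨hg, fun R => (hf.integrable_exp_mul_norm (R + c)).mono' ?_ (ae_of_all _ fun a => ?_)⟩
  · exact (Real.continuous_exp.comp_aestronglyMeasurable (hL.norm.const_mul R)).mul hg.norm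
  · rw [Real.norm_of_nonneg (by positivity), add_mul, Real.exp_add, mul_assoc]
    gcongr
    exact h a

lemma norm_cexp_le_exp_norm_mul (ℓ : E →L[ℝ] ℂ) (p : E) :
    ‖Complex.exp (ℓ p)‖ ≤ Real.exp (‖p‖ * ‖ℓ‖) :=
  (Complex.norm_exp_le_exp_norm _).trans
    (Real.exp_le_exp.2 ((ℓ.le_opNorm p).trans_eq (mul_comm _ _)))

variable [NormedSpace ℂ F]

lemma RapidlyDecaying.integrable_cexp_smul (hf : RapidlyDecaying μ L f)
    (hL : AEStronglyMeasurable L μ) (p : E) :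
    Integrable (fun a => Complex.exp (L a p) • f a) μ := by
  refine (hf.integrable_exp_mul_norm ‖p‖).mono' ?_ (ae_of_all _ fun a => ?_)
  · exact (Complex.continuous_exp.comp_aestronglyMeasurable
      (hL.apply_continuousLinearMap p)).smul hf.aestronglyMeasurable
  · rw [norm_smul]
    gcongr
    exact norm_cexp_le_exp_norm_mul _ _

variable [NormedSpace ℝ F]

lemma RapidlyDecaying.norm_laplaceIntegral_le (hf : RapidlyDecaying μ L f) {p p₀ : E} {c : ℝ}
    (h : ∀ a, (L a (p - p₀)).re ≤ c) :
    ‖laplaceIntegral μ L f p‖ ≤ Real.exp c * ∫ a, Real.exp (‖p₀‖ * ‖L a‖) * ‖f a‖ ∂μ := by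
  rw [← integral_const_mul]
  refine norm_integral_le_of_norm_le ((hf.integrable_exp_mul_norm ‖p₀‖).const_mul _)
    (ae_of_all _ fun a => ?_)
  have h_split : L a p = L a (p - p₀) + L a p₀ := by rw [← map_add, sub_add_cancel]
  rw [norm_smul, h_split, Complex.exp_add, norm_mul, Complex.norm_exp (L a (p - p₀)), ← mul_assoc]
  gcongr
  · exact h a
  · exact norm_cexp_le_exp_norm_mul _ _

variable [IsScalarTower ℝ ℂ F]

lemma RapidlyDecaying.smulRight (hf : RapidlyDecaying μ L f) (hL : AEStronglyMeasurable L μ) :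
    RapidlyDecaying μ L fun a => (L a).smulRight (f a) := by
  refine hf.of_norm_le hL ?_ (c := 1) fun a => ?_
  · have h_flip : AEStronglyMeasurable (fun a => (ContinuousLinearMap.lsmul ℝ ℂ).flip (f a)) μ :=
      (ContinuousLinearMap.lsmul ℝ ℂ).flip.continuous.comp_aestronglyMeasurable
        hf.aestronglyMeasurable
    exact (ContinuousLinearMap.compL ℝ E ℂ F).aestronglyMeasurable_comp₂ h_flip hL
  · refine ContinuousLinearMap.opNorm_le_bound _ (by positivity) fun p => ?_
    rw [ContinuousLinearMap.smulRight_apply, norm_smul, mul_right_comm, one_mul]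
    gcongr
    calc ‖L a p‖ ≤ ‖L a‖ * ‖p‖ := (L a).le_opNorm p
      _ ≤ Real.exp ‖L a‖ * ‖p‖ := by gcongr; linarith [Real.add_one_le_exp ‖L a‖]

lemma hasFDerivAt_cexp_smul (ℓ : E →L[ℝ] ℂ) (v : F) (p : E) :
    HasFDerivAt (fun q => Complex.exp (ℓ q) • v) (Complex.exp (ℓ p) • ℓ.smulRight v) p := by
  refine (ℓ.hasFDerivAt.cexp.smul_const v).congr_fderiv ?_
  ext q
  simp [mul_smul]

lemma RapidlyDecaying.hasFDerivAt_laplaceIntegral (hf : RapidlyDecaying μ L f)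
    (hL : AEStronglyMeasurable L μ) (p : E) :
    HasFDerivAt (laplaceIntegral μ L f)
      (laplaceIntegral μ L (fun a => (L a).smulRight (f a)) p) p := by
  have hf' := hf.smulRight hL
  refine hasFDerivAt_integral_of_dominated_of_fderiv_le (s := Metric.ball p 1)
    (F' := fun q a => Complex.exp (L a q) • (L a).smulRight (f a))
    (bound := fun a => Real.exp ((‖p‖ + 1) * ‖L a‖) * ‖(L a).smulRight (f a)‖)
    (Metric.ball_mem_nhds p one_pos)
    (.of_forall fun q => (hf.integrable_cexp_smul hL q).aestronglyMeasurable)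
    (hf.integrable_cexp_smul hL p) (hf'.integrable_cexp_smul hL p).aestronglyMeasurable
    (ae_of_all _ fun a q hq => ?_) (hf'.integrable_exp_mul_norm _)
    (ae_of_all _ fun a q _ => hasFDerivAt_cexp_smul _ _ _)
  have hq : ‖q‖ ≤ ‖p‖ + 1 := by
    linarith [norm_le_norm_add_norm_sub' q p, mem_ball_iff_norm.1 hq]
  rw [norm_smul]
  gcongr
  exact (norm_cexp_le_exp_norm_mul _ _).trans (by gcongr)

lemma RapidlyDecaying.hasDerivAt_laplaceIntegral_comp (hf : RapidlyDecaying μ L f)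
    (hL : AEStronglyMeasurable L μ) {γ : ℝ → E} {v : E} {t : ℝ} (hγ : HasDerivAt γ v t) :
    HasDerivAt (fun s => laplaceIntegral μ L f (γ s))
      (laplaceIntegral μ L (fun a => L a v • f a) (γ t)) t := by
  refine ((hf.hasFDerivAt_laplaceIntegral hL (γ t)).comp_hasDerivAt t hγ).congr_deriv ?_
  rw [laplaceIntegral, ContinuousLinearMap.integral_apply
    ((hf.smulRight hL).integrable_cexp_smul hL (γ t))]
  rfl

end

lemma RapidlyDecaying.contDiff_laplaceIntegral {E F : Type u} [NormedAddCommGroup E]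
    [NormedSpace ℝ E] [NormedAddCommGroup F] [NormedSpace ℝ F] [NormedSpace ℂ F]
    [IsScalarTower ℝ ℂ F] {L : Ω → E →L[ℝ] ℂ} {f : Ω → F} (hf : RapidlyDecaying μ L f)
    (hL : AEStronglyMeasurable L μ) : ContDiff ℝ ∞ (laplaceIntegral μ L f) := by
  rw [contDiff_infty]
  intro n
  induction n generalizing F with
  | zero =>
    rw [Nat.cast_zero, contDiff_zero]
    exact continuous_iff_continuousAt.2 fun p => (hf.hasFDerivAt_laplaceIntegral hL p).continuousAt
  | succ n ih =>
    rw [Nat.cast_succ, contDiff_succ_iff_hasFDerivAt]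
    exact ⟨_, ih (hf.smulRight hL), hf.hasFDerivAt_laplaceIntegral hL⟩

end Laplace

/-! ### The contour of the GSE kernel -/

section Contour

/-- The arc length parametrization `1 + |t| e^{± iπ/3}` of the two rays, with the sign of `t`. -/
def rayPoint (t : ℝ) : ℂ := ⟨1 + |t| / 2, √3 / 2 * t⟩

/-- The density of `dz / (2 i π)` along `rayPoint`. At the corner `t = 0`, where there is no
tangent, the value is irrelevant. -/
def rayDensity (t : ℝ) : ℂ := ⟨t / |t| / 2, √3 / 2⟩ / (2 * Real.pi * Complex.I)

lemma rayPoint_neg (t : ℝ) : rayPoint (-t) = starRingEnd ℂ (rayPoint t) := by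
  apply Complex.ext <;> simp [rayPoint]

lemma rayDensity_neg (t : ℝ) : rayDensity (-t) = starRingEnd ℂ (rayDensity t) := by
  have h_dir : (⟨-t / |-t| / 2, √3 / 2⟩ : ℂ) = -starRingEnd ℂ ⟨t / |t| / 2, √3 / 2⟩ := by
    apply Complex.ext <;> simp [neg_div]
  rw [rayDensity, rayDensity, h_dir]
  simp only [map_div₀, map_mul, Complex.conj_I, Complex.conj_ofReal,
    map_ofNat, mul_neg, div_neg, neg_div]

lemma exp_pi_div_three_mul_I :
    Complex.exp ((Real.pi / 3 : ℝ) * Complex.I) = ⟨1 / 2, √3 / 2⟩ := by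
  apply Complex.ext
  · rw [Complex.exp_ofReal_mul_I_re, Real.cos_pi_div_three]
  · rw [Complex.exp_ofReal_mul_I_im, Real.sin_pi_div_three]

lemma exp_neg_pi_div_three_mul_I : Complex.exp (-(Real.pi / 3 : ℝ) * Complex.I) =
    starRingEnd ℂ (Complex.exp ((Real.pi / 3 : ℝ) * Complex.I)) := by
  rw [← Complex.exp_conj, map_mul, Complex.conj_I, Complex.conj_ofReal, neg_mul, mul_neg]

lemma rayPoint_of_pos {t : ℝ} (ht : 0 < t) :
    rayPoint t = 1 + t * Complex.exp ((Real.pi / 3 : ℝ) * Complex.I) := by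
  rw [exp_pi_div_three_mul_I]
  apply Complex.ext <;> simp [rayPoint, abs_of_pos ht] <;> ring

lemma rayDensity_of_pos {t : ℝ} (ht : 0 < t) : rayDensity t =
    1 / (2 * Real.pi * Complex.I) * Complex.exp ((Real.pi / 3 : ℝ) * Complex.I) := by
  rw [exp_pi_div_three_mul_I, rayDensity, abs_of_pos ht, div_self ht.ne', one_div_mul_eq_div]

lemma rayIntegral_eq_integral {f : ℂ → ℂ}
    (hf : Integrable fun t => f (rayPoint t) * rayDensity t) :
    rayIntegral 1 (Real.pi / 3) f = ∫ t, f (rayPoint t) * rayDensity t := by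
  rw [← intervalIntegral.integral_Iic_add_Ioi (b := 0) hf.integrableOn hf.integrableOn, add_comm,
    ← neg_zero, ← integral_comp_neg_Ioi, neg_zero, rayIntegral, mul_sub, ← integral_const_mul,
    ← integral_const_mul, sub_eq_add_neg, ← integral_neg]
  congr 1
  · refine setIntegral_congr_fun measurableSet_Ioi fun t ht => ?_
    simp only [rayPoint_of_pos ht, rayDensity_of_pos ht]
    ring
  · refine setIntegral_congr_fun measurableSet_Ioi fun t ht => ?_
    simp only [rayPoint_neg, rayDensity_neg, rayPoint_of_pos ht, rayDensity_of_pos ht,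
      exp_neg_pi_div_three_mul_I, map_add, map_mul, map_div₀, map_one, map_ofNat, Complex.conj_I,
      Complex.conj_ofReal]
    ring

lemma rayDensity_ne_zero (t : ℝ) : rayDensity t ≠ 0 := by
  refine div_ne_zero (fun h => ?_) Complex.two_pi_I_ne_zero
  simpa using congrArg Complex.im h

lemma rayIntegral_rayIntegral_eq_integral {G : ℂ → ℂ → ℂ}
    (hG : Integrable fun p : ℝ × ℝ =>
      G (rayPoint p.1) (rayPoint p.2) * (rayDensity p.1 * rayDensity p.2)) :
    (rayIntegral 1 (Real.pi / 3) fun z => rayIntegral 1 (Real.pi / 3) fun w => G z w) =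
      ∫ p : ℝ × ℝ, G (rayPoint p.1) (rayPoint p.2) * (rayDensity p.1 * rayDensity p.2) := by
  have h_inner : (fun s => ∫ t, G (rayPoint s) (rayPoint t) * (rayDensity s * rayDensity t))
      =ᵐ[volume] fun s =>
        (rayIntegral 1 (Real.pi / 3) fun w => G (rayPoint s) w) * rayDensity s := by
    filter_upwards [hG.prod_right_ae] with s hs
    have h_split : ∀ t, G (rayPoint s) (rayPoint t) * (rayDensity s * rayDensity t) =
        G (rayPoint s) (rayPoint t) * rayDensity t * rayDensity s := fun t => by ring
    simp only [h_split] at hs ⊢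
    rw [integral_mul_const, rayIntegral_eq_integral]
    exact (integrable_mul_const_iff (rayDensity_ne_zero s).isUnit _).1 hs
  rw [rayIntegral_eq_integral (f := fun z => rayIntegral 1 (Real.pi / 3) fun w => G z w)
    (hG.integral_prod_left.congr h_inner), ← integral_congr_ae h_inner]
  exact (integral_prod _ hG).symm

lemma continuous_rayPoint : Continuous rayPoint := by
  have h_eq : rayPoint = fun t => Complex.equivRealProdCLM.symm (1 + |t| / 2, √3 / 2 * t) := by
    ext t
    apply Complex.ext <;> simp [rayPoint]
  rw [h_eq]
  fun_prop

lemma measurable_rayDensity : Measurable rayDensity := by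
  have h_dir : Measurable fun t : ℝ =>
      Complex.equivRealProdCLM.symm (t / |t| / 2, √3 / 2) :=
    Complex.equivRealProdCLM.symm.continuous.measurable.comp (by fun_prop)
  exact h_dir.div_const (2 * Real.pi * Complex.I)

lemma one_le_re_rayPoint (t : ℝ) : 1 ≤ (rayPoint t).re :=
  le_add_of_nonneg_right (by positivity)

lemma norm_rayPoint_le (t : ℝ) : ‖rayPoint t‖ ≤ 1 + |t| := by
  have h_sqrt : (√3 / 2) ^ 2 = 3 / 4 := by rw [div_pow, Real.sq_sqrt (by norm_num)]; norm_num
  refine le_of_sq_le_sq ?_ (by positivity)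
  rw [Complex.sq_norm, Complex.normSq_apply]
  simp only [rayPoint]
  nlinarith [abs_nonneg t, sq_abs t]

lemma norm_rayDensity_le (t : ℝ) : ‖rayDensity t‖ ≤ 1 := by
  have h_sqrt : (√3 / 2) ^ 2 = 3 / 4 := by rw [div_pow, Real.sq_sqrt (by norm_num)]; norm_num
  have h_sign : (t / |t|) ^ 2 ≤ 1 := by
    rw [div_pow, sq_abs]
    exact div_self_le_one _
  have h_dir : ‖(⟨t / |t| / 2, √3 / 2⟩ : ℂ)‖ ≤ 1 := by
    refine (sq_le_one_iff₀ (norm_nonneg _)).1 ?_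
    rw [Complex.sq_norm, Complex.normSq_apply]
    nlinarith
  have h_two_pi : 1 ≤ 2 * Real.pi := by linarith [Real.pi_gt_three]
  rw [rayDensity, norm_div]
  refine (div_le_self (norm_nonneg _) ?_).trans h_dir
  simpa [abs_of_pos Real.pi_pos] using h_two_pi

lemma re_rayPoint_pow_three_div_three (t : ℝ) :
    (rayPoint t ^ 3 / 3).re = 1 / 3 + |t| / 2 - |t| ^ 2 / 2 - |t| ^ 3 / 3 := by
  have h_sqrt : √3 ^ 2 = 3 := Real.sq_sqrt (by norm_num)
  have h_re : (rayPoint t ^ 3 / 3).re = (rayPoint t ^ 3).re / 3 := Complex.div_ofNat_re _ 3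
  rw [h_re, pow_succ, pow_two]
  simp only [Complex.mul_re, Complex.mul_im, rayPoint]
  linear_combination (-(1 + |t| / 2) / 4 * t ^ 2) * h_sqrt + (3 / 4 * (1 + |t| / 2)) * sq_abs t

/-- The density of `e^{z³/3} dz / (2 i π)` along `rayPoint`. -/
def rayWeight (t : ℝ) : ℂ := Complex.exp (rayPoint t ^ 3 / 3) * rayDensity t

lemma measurable_rayWeight : Measurable rayWeight :=
  (Complex.continuous_exp.comp ((continuous_rayPoint.pow 3).div_const 3)).measurable.mul
    measurable_rayDensity

lemma rayWeight_neg (t : ℝ) : rayWeight (-t) = starRingEnd ℂ (rayWeight t) := by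
  rw [rayWeight, rayWeight, rayPoint_neg, rayDensity_neg, map_mul, ← Complex.exp_conj,
    map_div₀, map_pow, map_ofNat]

lemma integrable_exp_mul_norm_rayWeight (R : ℝ) :
    Integrable fun t => Real.exp (R * ‖rayPoint t‖) * ‖rayWeight t‖ := by
  refine ((integrable_exp_neg_mul_sq (b := 1 / 4) (by norm_num)).const_mul
    (Real.exp (|R| + 1 / 3 + (|R| + 1 / 2) ^ 2))).mono' ?_ (ae_of_all _ fun t => ?_)
  · exact ((Real.continuous_exp.comp (continuous_rayPoint.norm.const_mul R)).measurable.mul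
      measurable_rayWeight.norm).aestronglyMeasurable
  · rw [Real.norm_of_nonneg (by positivity), rayWeight, norm_mul, Complex.norm_exp,
      re_rayPoint_pow_three_div_three]
    calc _ ≤ Real.exp (|R| * (1 + |t|)) *
          (Real.exp (1 / 3 + |t| / 2 - |t| ^ 2 / 2 - |t| ^ 3 / 3) * 1) := by
          gcongr
          · exact le_abs_self R
          · exact norm_rayPoint_le t
          · exact norm_rayDensity_le t
      _ ≤ _ := by
          rw [mul_one, ← Real.exp_add, ← Real.exp_add]
          refine Real.exp_le_exp.2 ?_
          have h_cube : 0 ≤ |t| ^ 3 := by positivity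
          nlinarith [sq_nonneg (|t| / 2 - (|R| + 1 / 2)), sq_abs t]

/-- The exponent `(x, y) ↦ -(x z + y w)`, for `z` and `w` on the rays. -/
def rayExponent (p : ℝ × ℝ) : ℝ × ℝ →L[ℝ] ℂ :=
  -((ContinuousLinearMap.fst ℝ ℝ ℝ).smulRight (rayPoint p.1) +
    (ContinuousLinearMap.snd ℝ ℝ ℝ).smulRight (rayPoint p.2))

lemma rayExponent_apply (p : ℝ × ℝ) (x y : ℝ) :
    rayExponent p (x, y) = -(x * rayPoint p.1 + y * rayPoint p.2) := rfl

lemma continuous_rayExponent : Continuous rayExponent := by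
  have h_point := continuous_rayPoint
  refine continuous_clm_apply.2 fun ⟨x, y⟩ => ?_
  simp only [rayExponent_apply]
  fun_prop

lemma norm_rayExponent_le (p : ℝ × ℝ) : ‖rayExponent p‖ ≤ ‖rayPoint p.1‖ + ‖rayPoint p.2‖ := by
  refine ContinuousLinearMap.opNorm_le_bound _ (by positivity) fun v => ?_
  rw [rayExponent_apply, norm_neg, add_mul, mul_comm ‖rayPoint p.1‖, mul_comm ‖rayPoint p.2‖]
  refine (norm_add_le _ _).trans ?_
  rw [norm_mul, norm_mul, Complex.norm_real, Complex.norm_real]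
  gcongr
  · exact norm_fst_le v
  · exact norm_snd_le v

lemma norm_rayPoint_fst_le (p : ℝ × ℝ) : ‖rayPoint p.1‖ ≤ ‖rayExponent p‖ := by
  simpa [rayExponent_apply] using (rayExponent p).le_opNorm (1, 0)

lemma norm_rayPoint_snd_le (p : ℝ × ℝ) : ‖rayPoint p.2‖ ≤ ‖rayExponent p‖ := by
  simpa [rayExponent_apply] using (rayExponent p).le_opNorm (0, 1)

lemma norm_rayPoint_sub_le (p : ℝ × ℝ) : ‖rayPoint p.1 - rayPoint p.2‖ ≤ ‖rayExponent p‖ := by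
  rw [norm_sub_rev, sub_eq_add_neg]
  simpa [rayExponent_apply] using (rayExponent p).le_opNorm (1, -1)

lemma rapidlyDecaying_rayWeight_mul_rayWeight :
    RapidlyDecaying volume rayExponent fun p => rayWeight p.1 * rayWeight p.2 := by
  have h_meas : AEStronglyMeasurable (fun p : ℝ × ℝ => rayWeight p.1 * rayWeight p.2) volume :=
    ((measurable_rayWeight.comp measurable_fst).mul
      (measurable_rayWeight.comp measurable_snd)).aestronglyMeasurable
  refine ⟨h_meas, fun R => ((integrable_exp_mul_norm_rayWeight |R|).mul_prod
    (integrable_exp_mul_norm_rayWeight |R|)).mono' ?_ (ae_of_all _ fun p => ?_)⟩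
  · exact (Real.continuous_exp.comp
      (continuous_rayExponent.norm.const_mul R)).aestronglyMeasurable.mul h_meas.norm
  · rw [Real.norm_of_nonneg (by positivity), norm_mul, mul_mul_mul_comm, ← Real.exp_add, ← mul_add]
    gcongr
    · exact le_abs_self R
    · exact norm_rayExponent_le p

lemma airyDoubleIntegral_eq_laplaceIntegral {g : ℂ → ℂ → ℂ}
    (hg : RapidlyDecaying volume rayExponent fun p =>
      g (rayPoint p.1) (rayPoint p.2) * (rayWeight p.1 * rayWeight p.2)) (x y : ℝ) :
    airyDoubleIntegral g x y = laplaceIntegral volume rayExponent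
      (fun p => g (rayPoint p.1) (rayPoint p.2) * (rayWeight p.1 * rayWeight p.2)) (x, y) := by
  have h_integrand : ∀ p : ℝ × ℝ, Complex.exp (rayExponent p (x, y)) •
      (g (rayPoint p.1) (rayPoint p.2) * (rayWeight p.1 * rayWeight p.2)) =
      g (rayPoint p.1) (rayPoint p.2) * Complex.exp (rayPoint p.1 ^ 3 / 3 + rayPoint p.2 ^ 3 / 3 -
        x * rayPoint p.1 - y * rayPoint p.2) * (rayDensity p.1 * rayDensity p.2) := fun p => by
    have h_exponent : rayPoint p.1 ^ 3 / 3 + rayPoint p.2 ^ 3 / 3 - x * rayPoint p.1 -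
        y * rayPoint p.2 = rayExponent p (x, y) + rayPoint p.1 ^ 3 / 3 + rayPoint p.2 ^ 3 / 3 := by
      rw [rayExponent_apply]
      ring
    rw [h_exponent, Complex.exp_add, Complex.exp_add, rayWeight, rayWeight, smul_eq_mul]
    ring
  have h_integrable := hg.integrable_cexp_smul continuous_rayExponent.aestronglyMeasurable (x, y)
  simp only [h_integrand] at h_integrable
  rw [laplaceIntegral]
  simp only [h_integrand]
  exact rayIntegral_rayIntegral_eq_integral (G := fun z w =>
    g z w * Complex.exp (z ^ 3 / 3 + w ^ 3 / 3 - x * z - y * w)) h_integrable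

end Contour

/-! ### The GSE kernel -/

section GSE

/-- The density of `z^m w^n (z - w) / (4 z w (z + w)) e^{z³/3 + w³/3}` with respect to
`dz dw / (2 i π)²` along the contours. -/
def gseDensity (m n : ℕ) (p : ℝ × ℝ) : ℂ :=
  rayPoint p.1 ^ m * rayPoint p.2 ^ n * ((rayPoint p.1 - rayPoint p.2) /
    (4 * rayPoint p.1 * rayPoint p.2 * (rayPoint p.1 + rayPoint p.2))) *
    (rayWeight p.1 * rayWeight p.2)

/-- `(-∂_x)^m (-∂_y)^n` of the entry `11` of the GSE kernel, as a contour integral. For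
`m, n ∈ {0, 1}` this is the entry `(m, n)` of the kernel. -/
def gseMoment (m n : ℕ) (x y : ℝ) : ℂ :=
  laplaceIntegral volume rayExponent (gseDensity m n) (x, y)

variable (m n : ℕ)

lemma one_le_norm_rayPoint (t : ℝ) : 1 ≤ ‖rayPoint t‖ :=
  (one_le_re_rayPoint t).trans (Complex.re_le_norm _)

lemma one_le_norm_rayPoint_add (s t : ℝ) : 1 ≤ ‖rayPoint s + rayPoint t‖ := by
  refine le_trans ?_ (Complex.re_le_norm _)
  rw [Complex.add_re]
  linarith [one_le_re_rayPoint s, one_le_re_rayPoint t]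

lemma rayPoint_ne_zero (t : ℝ) : rayPoint t ≠ 0 :=
  norm_pos_iff.1 (one_pos.trans_le (one_le_norm_rayPoint t))

lemma rayPoint_add_ne_zero (s t : ℝ) : rayPoint s + rayPoint t ≠ 0 :=
  norm_pos_iff.1 (one_pos.trans_le (one_le_norm_rayPoint_add s t))

lemma norm_rayPoint_quotient_le (p : ℝ × ℝ) : ‖(rayPoint p.1 - rayPoint p.2) /
    (4 * rayPoint p.1 * rayPoint p.2 * (rayPoint p.1 + rayPoint p.2))‖ ≤ ‖rayExponent p‖ := by
  rw [norm_div]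
  refine (div_le_self (norm_nonneg _) ?_).trans (norm_rayPoint_sub_le p)
  simp only [norm_mul, Complex.norm_ofNat]
  exact one_le_mul_of_one_le_of_one_le (one_le_mul_of_one_le_of_one_le
    (one_le_mul_of_one_le_of_one_le (by norm_num) (one_le_norm_rayPoint _))
    (one_le_norm_rayPoint _)) (one_le_norm_rayPoint_add _ _)

lemma rapidlyDecaying_gseDensity : RapidlyDecaying volume rayExponent (gseDensity m n) := by
  have h_point := continuous_rayPoint
  refine rapidlyDecaying_rayWeight_mul_rayWeight.of_norm_le (c := (m + n + 1 : ℕ))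
    continuous_rayExponent.aestronglyMeasurable (.mul ?_
      rapidlyDecaying_rayWeight_mul_rayWeight.aestronglyMeasurable) fun p => ?_
  · refine Continuous.aestronglyMeasurable (.mul (by fun_prop) (.div₀ ?_ ?_ fun p => ?_))
    · fun_prop
    · fun_prop
    · simp [rayPoint_ne_zero, rayPoint_add_ne_zero]
  · have h_exp : ‖rayExponent p‖ ≤ Real.exp ‖rayExponent p‖ := by
      linarith [Real.add_one_le_exp ‖rayExponent p‖]
    rw [gseDensity, norm_mul, norm_mul, norm_mul, norm_pow, norm_pow, Real.exp_nat_mul, pow_succ,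
      pow_add]
    gcongr
    · exact (norm_rayPoint_fst_le p).trans h_exp
    · exact (norm_rayPoint_snd_le p).trans h_exp
    · exact (norm_rayPoint_quotient_le p).trans h_exp

lemma gseDensity_neg (p : ℝ × ℝ) : gseDensity m n (-p) = starRingEnd ℂ (gseDensity m n p) := by
  simp only [gseDensity, Prod.fst_neg, Prod.snd_neg, rayPoint_neg, rayWeight_neg, map_mul,
    map_pow, map_div₀, map_sub, map_add, map_ofNat]

lemma gseDensity_swap (p : ℝ × ℝ) : gseDensity m n p.swap = -gseDensity n m p := by
  simp only [gseDensity, Prod.fst_swap, Prod.snd_swap]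
  rw [← neg_sub (rayPoint p.1), neg_div, mul_comm (rayWeight p.2), add_comm (rayPoint p.2),
    mul_right_comm 4, mul_comm (rayPoint p.2 ^ m)]
  ring

lemma conj_gseMoment (x y : ℝ) : starRingEnd ℂ (gseMoment m n x y) = gseMoment m n x y := by
  simp only [gseMoment, laplaceIntegral]
  rw [← integral_conj, ← integral_neg_eq_self]
  refine integral_congr_ae (ae_of_all _ fun p => ?_)
  simp only [rayExponent_apply, gseDensity_neg, smul_eq_mul, map_mul, ← Complex.exp_conj, map_neg,
    map_add, Complex.conj_ofReal, Prod.fst_neg, Prod.snd_neg, rayPoint_neg, Complex.conj_conj]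

lemma gseMoment_swap (x y : ℝ) : gseMoment m n y x = -gseMoment n m x y := by
  simp only [gseMoment, laplaceIntegral]
  rw [← integral_neg, Measure.volume_eq_prod, ← integral_prod_swap]
  refine integral_congr_ae (ae_of_all _ fun p => ?_)
  simp only [gseDensity_swap, rayExponent_apply, Prod.fst_swap, Prod.snd_swap, smul_neg]
  rw [add_comm]

lemma contDiff_gseMoment : ContDiff ℝ ∞ fun p : ℝ × ℝ => gseMoment m n p.1 p.2 :=
  (rapidlyDecaying_gseDensity m n).contDiff_laplaceIntegral
    continuous_rayExponent.aestronglyMeasurable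

lemma hasDerivAt_gseMoment_left (x y : ℝ) :
    HasDerivAt (fun s => gseMoment m n s y) (-gseMoment (m + 1) n x y) x := by
  refine ((rapidlyDecaying_gseDensity m n).hasDerivAt_laplaceIntegral_comp
    continuous_rayExponent.aestronglyMeasurable
    ((hasDerivAt_id x).prodMk (hasDerivAt_const x y))).congr_deriv ?_
  simp only [gseMoment, laplaceIntegral, ← integral_neg]
  refine integral_congr_ae (ae_of_all _ fun p => ?_)
  simp only [rayExponent_apply, gseDensity, smul_eq_mul, id_eq, Complex.ofReal_one,
    Complex.ofReal_zero]
  ring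

lemma hasDerivAt_gseMoment_right (x y : ℝ) :
    HasDerivAt (fun s => gseMoment m n x s) (-gseMoment m (n + 1) x y) y := by
  refine ((rapidlyDecaying_gseDensity m n).hasDerivAt_laplaceIntegral_comp
    continuous_rayExponent.aestronglyMeasurable
    ((hasDerivAt_const y x).prodMk (hasDerivAt_id y))).congr_deriv ?_
  simp only [gseMoment, laplaceIntegral, ← integral_neg]
  refine integral_congr_ae (ae_of_all _ fun p => ?_)
  simp only [rayExponent_apply, gseDensity, smul_eq_mul, id_eq, Complex.ofReal_one,
    Complex.ofReal_zero]
  ring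

lemma exists_norm_gseMoment_le {S : Set ℝ} (hS : BddBelow S) :
    ∃ C, ∀ x ∈ S, ∀ y ∈ S, ‖gseMoment m n x y‖ ≤ C * Real.exp (-x - y) := by
  obtain ⟨x₀, hx₀⟩ := hS
  refine ⟨Real.exp (2 * x₀) *
    ∫ p, Real.exp (‖(x₀, x₀)‖ * ‖rayExponent p‖) * ‖gseDensity m n p‖, fun x hx y hy => ?_⟩
  rw [mul_right_comm, ← Real.exp_add]
  refine (rapidlyDecaying_gseDensity m n).norm_laplaceIntegral_le fun p => ?_
  rw [Prod.mk_sub_mk, rayExponent_apply, Complex.neg_re, Complex.add_re, Complex.re_ofReal_mul,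
    Complex.re_ofReal_mul]
  nlinarith [hx₀ hx, hx₀ hy, one_le_re_rayPoint p.1, one_le_re_rayPoint p.2]

lemma airyDoubleIntegral_eq_gseMoment {g : ℂ → ℂ → ℂ} {m n : ℕ}
    (hg : ∀ z w, z ≠ 0 → w ≠ 0 → z + w ≠ 0 →
      g z w = z ^ m * w ^ n * ((z - w) / (4 * z * w * (z + w)))) (x y : ℝ) :
    airyDoubleIntegral g x y = gseMoment m n x y := by
  have h_density : (fun p : ℝ × ℝ => g (rayPoint p.1) (rayPoint p.2) *
      (rayWeight p.1 * rayWeight p.2)) = gseDensity m n := by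
    ext p
    rw [hg _ _ (rayPoint_ne_zero _) (rayPoint_ne_zero _) (rayPoint_add_ne_zero _ _), gseDensity]
  rw [airyDoubleIntegral_eq_laplaceIntegral (h_density ▸ rapidlyDecaying_gseDensity m n),
    h_density, gseMoment]

lemma gseContourKernel_apply (x y : ℝ) (i j : Fin 2) :
    gseContourKernel x y i j = gseMoment i j x y := by
  have h11 : gse11 x y = gseMoment 0 0 x y :=
    airyDoubleIntegral_eq_gseMoment (fun z w _ _ _ => by ring) x y
  have h12 : ∀ x y, gse12 x y = gseMoment 0 1 x y :=
    airyDoubleIntegral_eq_gseMoment fun z w _ _ _ => by field_simp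
  have h22 : gse22 x y = gseMoment 1 1 x y :=
    airyDoubleIntegral_eq_gseMoment (fun z w _ _ _ => by field_simp) x y
  fin_cases i <;> fin_cases j
  · exact h11
  · exact h12 x y
  · exact (congrArg Neg.neg (h12 y x)).trans (gseMoment_swap 1 0 y x).symm
  · exact h22

lemma ofReal_re_gseMoment (x y : ℝ) : ((gseMoment m n x y).re : ℂ) = gseMoment m n x y :=
  Complex.conj_eq_iff_re.1 (conj_gseMoment m n x y)

lemma kernelGSE_apply (x y : ℝ) (i j : Fin 2) : kernelGSE x y i j = (gseMoment i j x y).re :=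
  congrArg Complex.re (gseContourKernel_apply x y i j)

theorem ofReal_kernelGSE (x y : ℝ) (i j : Fin 2) :
    ((kernelGSE x y i j : ℝ) : ℂ) = gseContourKernel x y i j := by
  rw [kernelGSE_apply, gseContourKernel_apply, ofReal_re_gseMoment]

lemma scalarGSE_eq (x y : ℝ) : scalarGSE x y = (gseMoment 0 0 x y).re :=
  kernelGSE_apply x y 0 0

theorem scalarGSE_swap (x y : ℝ) : scalarGSE x y = -scalarGSE y x := by
  rw [scalarGSE_eq, scalarGSE_eq, gseMoment_swap 0 0 y x, Complex.neg_re]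

theorem contDiff_scalarGSE : ContDiff ℝ ∞ fun p : ℝ × ℝ => scalarGSE p.1 p.2 := by
  simp only [scalarGSE_eq]
  exact Complex.reCLM.contDiff.comp (contDiff_gseMoment 0 0)

lemma partialX_re_gseMoment (x y : ℝ) :
    partialX (fun x y => (gseMoment m n x y).re) x y = -(gseMoment (m + 1) n x y).re :=
  (Complex.reCLM.hasFDerivAt.comp_hasDerivAt x (hasDerivAt_gseMoment_left m n x y)).deriv

lemma partialY_re_gseMoment (x y : ℝ) :
    partialY (fun x y => (gseMoment m n x y).re) x y = -(gseMoment m (n + 1) x y).re :=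
  (Complex.reCLM.hasFDerivAt.comp_hasDerivAt y (hasDerivAt_gseMoment_right m n x y)).deriv

theorem kernelGSE_eq_kernelA : kernelGSE = kernelA scalarGSE := by
  have h_scalar : scalarGSE = fun x y => (gseMoment 0 0 x y).re := by
    ext x y
    exact scalarGSE_eq x y
  have hX : ∀ x y, partialX scalarGSE x y = -(gseMoment 1 0 x y).re :=
    h_scalar ▸ partialX_re_gseMoment 0 0
  have hY : ∀ x y, partialY scalarGSE x y = -(gseMoment 0 1 x y).re :=
    h_scalar ▸ partialY_re_gseMoment 0 0
  have hXY : ∀ x y, partialX (partialY scalarGSE) x y = (gseMoment 1 1 x y).re := fun x y => by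
    have h_deriv := partialX_re_gseMoment 0 1 x y
    rw [partialX] at h_deriv ⊢
    simp only [hY]
    rw [deriv.fun_neg, h_deriv, neg_neg]
  ext x y i j
  rw [kernelGSE_apply]
  fin_cases i <;> fin_cases j <;> simp [kernelA, hX, hY, hXY, scalarGSE_eq]

lemma expDecayOn_of_abs_le_exp {K : Kernel} {S : Set ℝ} (hS : BddBelow S)
    (h : ∀ i j, ∃ C, ∀ x ∈ S, ∀ y ∈ S, |K x y i j| ≤ C * Real.exp (-x - y)) : ExpDecayOn K S := by
  obtain ⟨x₀, hx₀⟩ := hS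
  choose C hC using h
  let D : ℝ := 1 + |C 0 0| + |C 0 1| + |C 1 1|
  have h_lt : ∀ {c k s u : ℝ}, |c| < D → |k| ≤ c * Real.exp s → s ≤ 2 * |x₀| + u →
      |k| < D * Real.exp (2 * |x₀|) * Real.exp u := fun {c k s u} hc hk hs =>
    calc |k| ≤ c * Real.exp s := hk
      _ ≤ |c| * Real.exp s := by gcongr; exact le_abs_self c
      _ < D * Real.exp s := by gcongr
      _ ≤ D * (Real.exp (2 * |x₀|) * Real.exp u) := by
        rw [← Real.exp_add]
        gcongr
      _ = _ := (mul_assoc _ _ _).symm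
  have h_nonneg : 0 ≤ |C 0 0| ∧ 0 ≤ |C 0 1| ∧ 0 ≤ |C 1 1| :=
    ⟨abs_nonneg _, abs_nonneg _, abs_nonneg _⟩
  refine ⟨D * Real.exp (2 * |x₀|), 1, 0, by positivity, le_rfl, one_pos, fun x hx y hy => ?_⟩
  have hx' : -|x₀| ≤ x := (neg_abs_le x₀).trans (hx₀ hx)
  have hy' : -|x₀| ≤ y := (neg_abs_le x₀).trans (hx₀ hy)
  have h_abs := abs_nonneg x₀
  exact ⟨h_lt (by linarith) (hC 0 0 x hx y hy) (by linarith),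
    h_lt (by linarith) (hC 0 1 x hx y hy) (by linarith),
    h_lt (by linarith) (hC 1 1 x hx y hy) (by linarith)⟩

lemma expDecayOn_kernelGSE {S : Set ℝ} (hS : BddBelow S) : ExpDecayOn kernelGSE S := by
  refine expDecayOn_of_abs_le_exp hS fun i j => ?_
  obtain ⟨C, hC⟩ := exists_norm_gseMoment_le i j hS
  refine ⟨C, fun x hx y hy => ?_⟩
  rw [kernelGSE_apply]
  exact (Complex.abs_re_le_norm _).trans (hC x hx y hy)

end GSE

end FredholmPf

end

theorem mainTheorem4_general :
    (∀ A : ℝ → ℝ → ℝ, ContDiff ℝ 3 (fun p : ℝ × ℝ => A p.1 p.2) →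
      (∀ x y : ℝ, A x y = -A y x) →
      ∀ S : Set ℝ, MeasurableSet S → BddBelow S →
        FredholmPf.ExpDecayOn (FredholmPf.kernelA A) S →
        FredholmPf.FredholmConverges (-FredholmPf.kernelA A) S ∧
        (-FredholmPf.kernelB A).FredholmConverges S ∧
        FredholmPf.fredholmPfaffian (-FredholmPf.kernelA A) S =
          (-FredholmPf.kernelB A).fredholmPfaffian S) ∧
    (∀ (x y : ℝ) (i j : Fin 2),
      ((FredholmPf.kernelGSE x y i j : ℝ) : ℂ) = FredholmPf.gseContourKernel x y i j) ∧
    ContDiff ℝ ∞ (fun p : ℝ × ℝ => FredholmPf.scalarGSE p.1 p.2) ∧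
    (∀ x y : ℝ, FredholmPf.scalarGSE x y = -FredholmPf.scalarGSE y x) ∧
    FredholmPf.kernelGSE = FredholmPf.kernelA FredholmPf.scalarGSE ∧
    ∀ S : Set ℝ, MeasurableSet S → BddBelow S →
      FredholmPf.FredholmConverges (-FredholmPf.kernelGSE) S ∧
      (-FredholmPf.kernelInfinity).FredholmConverges S ∧
      FredholmPf.fredholmPfaffian (-FredholmPf.kernelGSE) S =
        (-FredholmPf.kernelInfinity).fredholmPfaffian S := by
  refine ⟨fun A hA hA' S hS hS' => FredholmPf.fredholmPfaffian_kernelA_eq_kernelB hS hS' hA hA',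
    FredholmPf.ofReal_kernelGSE, FredholmPf.contDiff_scalarGSE, FredholmPf.scalarGSE_swap,
    FredholmPf.kernelGSE_eq_kernelA, fun S hS hS' => ?_⟩
  have h_decay := FredholmPf.expDecayOn_kernelGSE hS'
  rw [FredholmPf.kernelGSE_eq_kernelA] at h_decay ⊢
  exact FredholmPf.fredholmPfaffian_kernelA_eq_kernelB hS hS'
    (contDiff_infty.1 FredholmPf.contDiff_scalarGSE 3) FredholmPf.scalarGSE_swap
    h_decay

theorem mainTheorem4 :
    (∀ A : ℝ → ℝ → ℝ, ContDiff ℝ ∞ (fun p : ℝ × ℝ => A p.1 p.2) →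
      (∀ x y : ℝ, A x y = -A y x) →
      ∀ x₀ : ℝ, FredholmPf.ExpDecayOn (FredholmPf.kernelA A) (Set.Ioi x₀) →
        FredholmPf.FredholmConverges (-FredholmPf.kernelA A) (Set.Ioi x₀) ∧
        (-FredholmPf.kernelB A).FredholmConverges (Set.Ioi x₀) ∧
        FredholmPf.fredholmPfaffian (-FredholmPf.kernelA A) (Set.Ioi x₀) =
          (-FredholmPf.kernelB A).fredholmPfaffian (Set.Ioi x₀)) ∧
    (∀ (x y : ℝ) (i j : Fin 2),
      ((FredholmPf.kernelGSE x y i j : ℝ) : ℂ) = FredholmPf.gseContourKernel x y i j) ∧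
    ContDiff ℝ ∞ (fun p : ℝ × ℝ => FredholmPf.scalarGSE p.1 p.2) ∧
    (∀ x y : ℝ, FredholmPf.scalarGSE x y = -FredholmPf.scalarGSE y x) ∧
    FredholmPf.kernelGSE = FredholmPf.kernelA FredholmPf.scalarGSE ∧
    ∀ x₀ : ℝ,
      FredholmPf.FredholmConverges (-FredholmPf.kernelGSE) (Set.Ioi x₀) ∧
      (-FredholmPf.kernelInfinity).FredholmConverges (Set.Ioi x₀) ∧
      FredholmPf.fredholmPfaffian (-FredholmPf.kernelGSE) (Set.Ioi x₀) =
        (-FredholmPf.kernelInfinity).fredholmPfaffian (Set.Ioi x₀) := by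
  obtain ⟨h_pfaffian, h_real, h_smooth, h_swap, h_eq, h_gse⟩ := mainTheorem4_general
  exact ⟨fun A hA hA' x₀ => h_pfaffian A (contDiff_infty.1 hA 3) hA' _
    measurableSet_Ioi bddBelow_Ioi, h_real, h_smooth, h_swap, h_eq,
    fun _ => h_gse _ measurableSet_Ioi bddBelow_Ioi⟩
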